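/- **Setting.** An (embedded) polygon $P$ is given by $n\ge 3$ pairwise distinct points $v_1,\dots,v_n\in\mathbb R^2$ (indices cyclic) such that distinct open edges $v_iv_{i+1}$ and $v_jv_{j+1}$ are disjoint, no open edge contains a vertex, and no three consecutive vertices are collinear; $P$ also denotes the closed curve $\bigcup_i\overline{v_iv_{i+1}}$, $V$ its vertex set, and $\mathrm{int}(P)$ the bounded component of $\mathbb R^2\setminus P$. Here $xz$ is the open segment from $x$ to $z$. Polygons need not be convex. Let $P_-,P_+$ be polygons with vertex sets $V_-,V_+$. Let $\mathcal P_{\max}$ be the set of $(x,y)\in(P_-\times P_+)\sqcup(P_+\times P_-)$, say $x\in P_\pm$ and $y\in P_\mp$, such that $y\notin V_\mp$ and there is a unique $z\in P_\pm$, $z\neq x$, on the line through $x$ parallel to the edge of $P_\mp$ containing $y$, with $xz\subset\mathrm{int}(P_\pm)$. The symplectic billiard map is $\phi(x,y)=(y,z)$ on $\mathcal P_{\max}$. Let $\sigma(x,y)=(y,x)$, let $\pi_2$ be the projection to the second factor, $N_0=(P_-\times V_+)\sqcup(P_+\times V_-)$, $N_{i+1}=\phi^{-1}(N_i)\subset\mathcal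 P_{\max}$, and $$N=\bigcup_{i\ge0}N_i\cup\sigma\Big(\bigcup_{i\ge 0}N_i\Big),\qquad \mathcal P=\mathcal P_{\max}\setminus N,\qquad C=\bigcup_{i\ge0}\pi_2(N_{2i})\subset P_-\sqcup P_+ .$$ The set $C$ is the set of critical points, and the $C$-grid $C^\#$ is the set of all $(x,y)\in(P_-\times P_+)\sqcup(P_+\times P_-)$ with $x\in C$ or $y\in C$. The orbit of $p\in\mathcal P$ is the bi-infinite sequence $(\phi^k(p))_{k\in\mathbb Z}$ in $\mathcal P$; part of the assertion is that it exists in the cases below. "Almost every" refers to the measure on $(P_-\times P_+)\sqcup(P_+\times P_-)$ which, on the product of an edge of one polygon with edge vector $e$ and an edge of the other with edge vector $e'$, is the constant multiple of length times length with total mass $|\det(e,e')|$. **Theorem (Periodicity criterion).** (I) If every limit point of $C$ is a vertex of $P_-\sqcup P_+$, then the orbit of every point of $\mathcal P$ is periodic. (II) If $C$ is closed, then the orbit of every point of $\mathcal P\setminus C^\#$ is periodic. In particular, almost every point of $\mathcal P_{\max}$ lies in $\mathcal P$ and has a periodic orbit. (III) If $C$ is finite, then the orbit of every point of $\mathcal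 P$ is periodic with period at most $4\,|C\cap P_-|\,|C\cap P_+|$. If moreover $P_-=P_+=P$ (single table) and $|C|$ denotes the number of critical points on one copy of $P$, then the period of every orbit is at most $2(|C|^2-|C|)$, both for the billiard map on $(P\times P)\sqcup(P\times P)$ as above and for the single-table billiard map $(x,y)\mapsto(y,z)$ on $P\times P$ (on the set of pairs corresponding to $\mathcal P$), where the two copies of $P$ are identified. -/

import Mathlib

open Set MeasureTheory Filter Topology

noncomputable section

namespace SymplecticBilliard

/-- The plane `ℝ²`. Only its linear structure, its topology, its bounded sets and Lebesgue measure
are used below, and none of these depends on the choice of a norm. -/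
abbrev Plane : Type := ℝ × ℝ

/-- An embedded polygon: a cyclic list of `n ≥ 3` pairwise distinct vertices, such that distinct
open edges are disjoint, no vertex lies on an open edge, and no three consecutive vertices are
collinear. Indices are read cyclically. -/
structure Polygon where
  /-- number of vertices -/
  n : ℕ
  three_le : 3 ≤ n
  /-- the vertices, in cyclic order -/
  vertex : ZMod n → Plane
  vertex_injective : Function.Injective vertex
  edges_disjoint : ∀ i j, i ≠ j →
    Disjoint (openSegment ℝ (vertex i) (vertex (i + 1)))
      (openSegment ℝ (vertex j) (vertex (j + 1)))
  vertex_notMem_edge : ∀ i j, vertex i ∉ openSegment ℝ (vertex j) (vertex (j + 1))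
  not_collinear : ∀ i, ¬ Collinear ℝ {vertex i, vertex (i + 1), vertex (i + 2)}

namespace Polygon

/-- The set of vertices. -/
def vertices (A : Polygon) : Set Plane := range A.vertex

/-- The open edge from the `i`-th vertex to the next one. -/
def openEdge (A : Polygon) (i : ZMod A.n) : Set Plane :=
  openSegment ℝ (A.vertex i) (A.vertex (i + 1))

/-- The edge vector from the `i`-th vertex to the next one. -/
def edgeVector (A : Polygon) (i : ZMod A.n) : Plane := A.vertex (i + 1) - A.vertex i

/-- The polygon as a closed curve: the union of its closed edges. -/
def curve (A : Polygon) : Set Plane := ⋃ i, segment ℝ (A.vertex i) (A.vertex (i + 1))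

/-- The interior of the polygon: the bounded component of the complement of the curve. -/
def inside (A : Polygon) : Set Plane :=
  {p | p ∈ A.curveᶜ ∧ Bornology.IsBounded (connectedComponentIn A.curveᶜ p)}

end Polygon

/-! A pair of tables is `P : Bool → Polygon`, with `P false = P₋` and `P true = P₊`. The disjoint
union `P₋ ⊔ P₊` consists of the `(b, x) : Bool × Plane` with `x` on `P b`, and the disjoint union
`(P₋ × P₊) ⊔ (P₊ × P₋)` of the `(b, x, y) : PhasePoint` with `x` on `P b` and `y` on `P !b`. -/

/-- The ambient type of `(P₋ × P₊) ⊔ (P₊ × P₋)`; the label says on which table the first point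
lies, and the second point lies on the other table. -/
abbrev PhasePoint : Type := Bool × Plane × Plane

/-- The set `(P₋ × P₊) ⊔ (P₊ × P₋)`. -/
def pairs (P : Bool → Polygon) : Set PhasePoint :=
  {p | p.2.1 ∈ (P p.1).curve ∧ p.2.2 ∈ (P !p.1).curve}

/-- The swap map `σ (x, y) = (y, x)`. -/
def swap (p : PhasePoint) : PhasePoint := (!p.1, p.2.2, p.2.1)

/-- The projection to the second factor, with values in `P₋ ⊔ P₊`. -/
def proj₂ (p : PhasePoint) : Bool × Plane := (!p.1, p.2.2)

/-- For a table `A` carrying `x`, and a table `B` carrying `y` on an open edge: `z` is a point of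
`A`, other than `x`, on the line through `x` parallel to the edge of `B` containing `y`, and the
open segment from `x` to `z` lies in the interior of `A`. -/
def Reflects (A B : Polygon) (x y z : Plane) : Prop :=
  z ∈ A.curve ∧ z ≠ x ∧
    (∃ j, y ∈ B.openEdge j ∧ ∃ t : ℝ, z = x + t • B.edgeVector j) ∧
    openSegment ℝ x z ⊆ A.inside

/-- The maximal phase space: the pairs `(x, y)` with `y` not a vertex and with a unique
reflected point `z`. -/
def maxPhaseSpace (P : Bool → Polygon) : Set PhasePoint :=
  {p | p ∈ pairs P ∧ p.2.2 ∉ (P !p.1).vertices ∧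
    ∃! z, Reflects (P p.1) (P !p.1) p.2.1 p.2.2 z}

/-- The symplectic billiard map `φ (x, y) = (y, z)`. It is meaningful on `maxPhaseSpace P`
only, where `z` is the unique reflected point. -/
def billiardMap (P : Bool → Polygon) (p : PhasePoint) : PhasePoint :=
  (!p.1, p.2.2, Classical.epsilon fun z => Reflects (P p.1) (P !p.1) p.2.1 p.2.2 z)

/-- The sets `N₀ = (P₋ × V₊) ⊔ (P₊ × V₋)` and `N_{i+1} = φ⁻¹ (N_i)`, a subset of the maximal
phase space, on which `φ` is defined. -/
def discontinuityLevel (P : Bool → Polygon) : ℕ → Set PhasePoint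
  | 0 => {p | p.2.1 ∈ (P p.1).curve ∧ p.2.2 ∈ (P !p.1).vertices}
  | i + 1 => {p | p ∈ maxPhaseSpace P ∧ billiardMap P p ∈ discontinuityLevel P i}

/-- The discontinuity set `N = ⋃ N_i ∪ σ (⋃ N_i)`. -/
def discontinuitySet (P : Bool → Polygon) : Set PhasePoint :=
  (⋃ i, discontinuityLevel P i) ∪ swap '' (⋃ i, discontinuityLevel P i)

/-- The phase space: the maximal phase space without the discontinuity set. -/
def phaseSpace (P : Bool → Polygon) : Set PhasePoint :=
  maxPhaseSpace P \ discontinuitySet P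

/-- The set `C` of critical points, a subset of `P₋ ⊔ P₊`. -/
def criticalPoints (P : Bool → Polygon) : Set (Bool × Plane) :=
  ⋃ i, proj₂ '' discontinuityLevel P (2 * i)

/-- The critical points on the table `P b`. -/
def criticalPointsOn (P : Bool → Polygon) (b : Bool) : Set Plane :=
  {x | (b, x) ∈ criticalPoints P}

/-- The `C`-grid: the pairs with at least one critical entry. -/
def criticalGrid (P : Bool → Polygon) : Set PhasePoint :=
  {p | p ∈ pairs P ∧
    (p.2.1 ∈ criticalPointsOn P p.1 ∨ p.2.2 ∈ criticalPointsOn P !p.1)}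

/-- `o` is the bi-infinite orbit of `p` under `f` in `S`. -/
def IsOrbit {X : Type*} (f : X → X) (S : Set X) (p : X) (o : ℤ → X) : Prop :=
  o 0 = p ∧ ∀ k, o k ∈ S ∧ f (o k) = o (k + 1)

/-- The bi-infinite orbit of `p` under `f` in `S` exists, and it is periodic with (not necessarily
minimal) period `n ≥ 1`. -/
def HasOrbitOfPeriod {X : Type*} (f : X → X) (S : Set X) (p : X) (n : ℕ) : Prop :=
  0 < n ∧ (∃ o, IsOrbit f S p o) ∧ ∀ o, IsOrbit f S p o → ∀ k : ℤ, o (k + n) = o k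

/-- The determinant of two plane vectors. -/
def det (u v : Plane) : ℝ := u.1 * v.2 - u.2 * v.1

/-- The symplectic area measure on `(P₋ × P₊) ⊔ (P₊ × P₋)`: on the product of an edge with edge
vector `e` and an edge of the other table with edge vector `e'` it is the multiple of
length times length that has total mass `|det (e, e')|`. -/
def areaMeasure (P : Bool → Polygon) : Measure PhasePoint :=
  Measure.sum fun b : Bool => Measure.sum fun i : ZMod (P b).n =>
    Measure.sum fun j : ZMod (P !b).n =>
      ENNReal.ofReal |det ((P b).edgeVector i) ((P !b).edgeVector j)| •
        Measure.map
          (fun s : ℝ × ℝ => ((b, (P b).vertex i + s.1 • (P b).edgeVector i,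
            (P !b).vertex j + s.2 • (P !b).edgeVector j) : PhasePoint))
          ((volume : Measure (ℝ × ℝ)).restrict (Ioo 0 1 ×ˢ Ioo 0 1))

/-! A single table `A` is the pair of tables `P₋ = P₊ = A` with the labels forgotten, so that an
orbit may close up in the single table after an odd number of steps. -/

/-- The pair of tables `P₋ = P₊ = A`. -/
def doubled (A : Polygon) : Bool → Polygon := fun _ => A

/-- The symplectic billiard map of a single table, on pairs of points of this table. -/
def singleMap (A : Polygon) (q : Plane × Plane) : Plane × Plane :=
  (billiardMap (doubled A) (false, q)).2

/-- The phase space of a single table. -/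
def singlePhaseSpace (A : Polygon) : Set (Plane × Plane) :=
  {q | (false, q) ∈ phaseSpace (doubled A)}

/-- The critical points of a single table. -/
def singleCriticalPoints (A : Polygon) : Set Plane := criticalPointsOn (doubled A) false

end SymplecticBilliard

end

/-!
The theorem rests on the fact that the phase space is cut into *tiles*, the classes of points whose
bi-infinite orbits visit the same edges, and that on a tile every iterate of the billiard map `φ`
is affine in each of the two entries separately.

*The map is well defined on the phase space.* From a point of an open edge and for a direction
transversal to this edge, exactly one chord of the polygon starts (`existsUnique_isChord`). This
needs the local form of the Jordan curve theorem: one side of each open edge is inside and the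
other one is not (`exists_orientation`). Both sides cannot be outside, because the winding number,
which vanishes on unbounded components, jumps across the edge; and walking along the polygon
carries one outside side to the next edge, while some side is outside since the plane without the
vertices is connected. Hence `φ` preserves the phase space and is a permutation of it, whose
inverse is the conjugate of `φ` by the swap map (`flow`).

*Tiles are bounded by critical points.* Move one entry of `(x, y)` along its edge. The iterates
move continuously and can leave their edges only through a vertex, and when this happens the moved
entry is by definition a critical point. So moving an entry without meeting `C` does not change the
tile (`exists_sameTile_snd`, `exists_sameTile_fst`). If `x` and `y` are not limit points of `C`,
the tile of `(x, y)` contains a rectangle around it (`exists_hasBox`). This holds for all points of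
the phase space in (I), whose entries are no vertices, and in (III), and for the points off the
`C`-grid in (II).

*Tiles return.* The map `φ` takes rectangles to rectangles of the same symplectic area
(`HasBox.flow`), so the sides of the iterated rectangles are bounded below, and two iterates must
lie in the same tile (`HasBox.exists_hasOrbitOfPeriod`). If `C` is finite, each tile instead
contains a rectangle of the complement of the `C`-grid, which is determined by its corner, a pair
of critical points; this bounds the number of tiles (`sameTile_of_corner_eq`).

*A returning tile is periodic.* If an even iterate takes a tile to itself, then in each entry it is
an affine map all of whose bi-infinite orbits are bounded, that is, the identity or a reflection;
its square is the identity (`flow_pow_eq_self`). This yields twice the number of tiles as a bound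
for the period. For a single table only the `|C|² - |C|` corners off the diagonal occur, since the
two entries never lie on the same edge. If a tile has an odd period `n`, its points have period `4
n`, but then its orbit is disjoint from the orbit of the swapped tile (`not_sameTile_flip`), so
that `2 n` tiles are accounted for.

*Almost every point.* The entries that lead to a vertex after finitely many steps are the preimages
of the vertices under countably many affine maps (`exists_countable_exceptional`), so they form a
null set.
-/

noncomputable section

namespace SymplecticBilliard

/-! ### Determinants and edges -/

lemma det_add_right (u v w : Plane) : det u (v + w) = det u v + det u w := by
  simp only [det, Prod.fst_add, Prod.snd_add]; ring

lemma det_sub_right (u v w : Plane) : det u (v - w) = det u v - det u w := by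
  simp only [det, Prod.fst_sub, Prod.snd_sub]; ring

lemma det_smul_right (t : ℝ) (u v : Plane) : det u (t • v) = t * det u v := by
  simp only [det, Prod.smul_fst, Prod.smul_snd, smul_eq_mul]; ring

lemma det_self (u : Plane) : det u u = 0 := by simp only [det]; ring

lemma det_comm (u v : Plane) : det u v = -det v u := by simp only [det]; ring

lemma continuous_det (u : Plane) : Continuous fun v => det u v := by unfold det; fun_prop

lemma sq_add_sq_pos {u : Plane} (hu : u ≠ 0) : 0 < u.1 * u.1 + u.2 * u.2 := by
  rcases eq_or_ne u.1 0 with h | h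
  · have h2 : u.2 ≠ 0 := fun h' => hu (Prod.ext h h')
    have := mul_self_pos.2 h2
    nlinarith [mul_self_nonneg u.1]
  · have := mul_self_pos.2 h
    nlinarith [mul_self_nonneg u.2]

lemma exists_eq_smul_of_det_eq_zero {u v : Plane} (hu : u ≠ 0) (h : det u v = 0) :
    ∃ t : ℝ, v = t • u := by
  have hp := (sq_add_sq_pos hu).ne'
  unfold det at h
  refine ⟨(v.1 * u.1 + v.2 * u.2) / (u.1 * u.1 + u.2 * u.2), Prod.ext ?_ ?_⟩
  · rw [Prod.smul_fst, smul_eq_mul, div_mul_eq_mul_div, eq_div_iff hp]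
    linear_combination (-u.2) * h
  · rw [Prod.smul_snd, smul_eq_mul, div_mul_eq_mul_div, eq_div_iff hp]
    linear_combination u.1 * h

lemma openSegment_eq_add_smul (x z : Plane) :
    openSegment ℝ x z = (fun t : ℝ => x + t • (z - x)) '' Ioo 0 1 :=
  openSegment_eq_image' ℝ x z

namespace Polygon

variable (A : Polygon)

instance : NeZero A.n := ⟨by have := A.three_le; omega⟩

lemma vertex_add_one (i : ZMod A.n) : A.vertex (i + 1) = A.vertex i + A.edgeVector i := by
  simp [edgeVector]

lemma one_ne_zero_index : (1 : ZMod A.n) ≠ 0 := by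
  have h := A.three_le
  intro h1
  have : A.n ∣ 1 := (ZMod.natCast_eq_zero_iff 1 A.n).1 (by exact_mod_cast h1)
  have := Nat.le_of_dvd one_pos this
  omega

lemma edgeVector_ne_zero (i : ZMod A.n) : A.edgeVector i ≠ 0 := by
  intro h
  have h1 := A.vertex_injective (sub_eq_zero.1 h)
  exact A.one_ne_zero_index (by simpa using h1)

/-- The signed distance to the line carrying the `i`-th edge, up to a constant factor; positive on
the left of the edge. -/
def level (i : ZMod A.n) (q : Plane) : ℝ := det (A.edgeVector i) (q - A.vertex i)

/-- The affine coordinate along the `i`-th edge of the orthogonal projection to its line. -/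
def param (i : ZMod A.n) (q : Plane) : ℝ :=
  ((q - A.vertex i).1 * (A.edgeVector i).1 + (q - A.vertex i).2 * (A.edgeVector i).2) /
    ((A.edgeVector i).1 * (A.edgeVector i).1 + (A.edgeVector i).2 * (A.edgeVector i).2)

/-- The closed edge from the `i`-th vertex to the next one. -/
def closedEdge (i : ZMod A.n) : Set Plane := segment ℝ (A.vertex i) (A.vertex (i + 1))

variable {A} {i j : ZMod A.n} {x q : Plane}

lemma continuous_level : Continuous (A.level i) :=
  (continuous_det _).comp (by fun_prop)

lemma continuous_param : Continuous (A.param i) := by unfold param; fun_prop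

lemma level_add_smul (q d : Plane) (t : ℝ) :
    A.level i (q + t • d) = A.level i q + t * det (A.edgeVector i) d := by
  simp only [level, add_sub_right_comm, det_add_right, det_smul_right]

lemma level_vertex : A.level i (A.vertex i) = 0 := by simp [level, det]

lemma level_on_line (s : ℝ) : A.level i (A.vertex i + s • A.edgeVector i) = 0 := by
  rw [level_add_smul, level_vertex, det_self]; simp

lemma param_on_line (s : ℝ) : A.param i (A.vertex i + s • A.edgeVector i) = s := by
  have := (sq_add_sq_pos (A.edgeVector_ne_zero i)).ne'
  simp only [param, add_sub_cancel_left, Prod.smul_fst, Prod.smul_snd, smul_eq_mul]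
  rw [div_eq_iff this]; ring

lemma eq_of_level_eq_zero (h : A.level i q = 0) :
    q = A.vertex i + A.param i q • A.edgeVector i := by
  obtain ⟨t, ht⟩ := exists_eq_smul_of_det_eq_zero (A.edgeVector_ne_zero i) h
  obtain rfl : q = A.vertex i + t • A.edgeVector i := by rw [← ht]; abel
  rw [param_on_line]

lemma mem_openEdge_iff_exists :
    q ∈ A.openEdge i ↔ ∃ s : ℝ, 0 < s ∧ s < 1 ∧ q = A.vertex i + s • A.edgeVector i := by
  rw [openEdge, openSegment_eq_add_smul]
  simp only [mem_image, mem_Ioo, edgeVector, and_assoc, eq_comm]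

lemma mem_closedEdge_iff_exists :
    q ∈ A.closedEdge i ↔ ∃ s : ℝ, 0 ≤ s ∧ s ≤ 1 ∧ q = A.vertex i + s • A.edgeVector i := by
  rw [closedEdge, segment_eq_image']
  simp only [mem_image, mem_Icc, edgeVector, and_assoc, eq_comm]

lemma mem_openEdge_iff :
    q ∈ A.openEdge i ↔ A.level i q = 0 ∧ 0 < A.param i q ∧ A.param i q < 1 := by
  rw [mem_openEdge_iff_exists]
  constructor
  · rintro ⟨s, h0, h1, rfl⟩
    rw [level_on_line, param_on_line]; exact ⟨rfl, h0, h1⟩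
  · rintro ⟨h, h0, h1⟩
    exact ⟨_, h0, h1, eq_of_level_eq_zero h⟩

lemma level_of_mem_closedEdge (h : q ∈ A.closedEdge i) : A.level i q = 0 := by
  obtain ⟨s, -, -, rfl⟩ := mem_closedEdge_iff_exists.1 h
  exact level_on_line s

lemma vertex_mem_closedEdge : A.vertex i ∈ A.closedEdge i := left_mem_segment _ _ _

lemma closedEdge_subset_curve : A.closedEdge i ⊆ A.curve :=
  subset_iUnion (fun i => segment ℝ (A.vertex i) (A.vertex (i + 1))) i

lemma openEdge_subset_closedEdge : A.openEdge i ⊆ A.closedEdge i := openSegment_subset_segment _ _ _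

lemma openEdge_subset_curve : A.openEdge i ⊆ A.curve :=
  openEdge_subset_closedEdge.trans closedEdge_subset_curve

lemma vertex_mem_curve (i : ZMod A.n) : A.vertex i ∈ A.curve :=
  closedEdge_subset_curve vertex_mem_closedEdge

lemma vertices_subset_curve : A.vertices ⊆ A.curve := by
  rintro _ ⟨i, rfl⟩; exact vertex_mem_curve i

lemma mem_curve_iff : q ∈ A.curve ↔ ∃ i, q ∈ A.closedEdge i := mem_iUnion

lemma mem_closedEdge_iff :
    q ∈ A.closedEdge i ↔ q ∈ A.openEdge i ∨ q = A.vertex i ∨ q = A.vertex (i + 1) := by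
  rw [closedEdge, ← insert_endpoints_openSegment]
  simp only [mem_insert_iff, openEdge]; tauto

lemma mem_curve_iff_openEdge : q ∈ A.curve ↔ q ∈ A.vertices ∨ ∃ i, q ∈ A.openEdge i := by
  constructor
  · intro h
    obtain ⟨i, hi⟩ := mem_curve_iff.1 h
    rcases mem_closedEdge_iff.1 hi with h | h | h
    · exact Or.inr ⟨i, h⟩
    · exact Or.inl ⟨i, h.symm⟩
    · exact Or.inl ⟨i + 1, h.symm⟩
  · rintro (h | ⟨i, h⟩)
    · exact vertices_subset_curve h
    · exact openEdge_subset_curve h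

lemma openEdge_unique (hi : q ∈ A.openEdge i) (hj : q ∈ A.openEdge j) : i = j := by
  by_contra h
  exact disjoint_left.1 (A.edges_disjoint i j h) hi hj

lemma notMem_vertices_of_mem_openEdge (h : q ∈ A.openEdge i) : q ∉ A.vertices := by
  rintro ⟨j, rfl⟩; exact A.vertex_notMem_edge j i h

lemma exists_mem_openEdge (h : q ∈ A.curve) (hv : q ∉ A.vertices) : ∃ i, q ∈ A.openEdge i :=
  (mem_curve_iff_openEdge.1 h).resolve_left hv

lemma isCompact_closedEdge : IsCompact (A.closedEdge i) := by
  rw [closedEdge, segment_eq_image']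
  exact isCompact_Icc.image (by fun_prop)

lemma isCompact_curve : IsCompact A.curve := isCompact_iUnion fun _ => isCompact_closedEdge

lemma isClosed_curve : IsClosed A.curve := isCompact_curve.isClosed

lemma finite_vertices : A.vertices.Finite := finite_range _

/-- Near a point, the curve is the union of the closed edges through this point. -/
lemma eventually_mem_closedEdge (x : Plane) :
    ∀ᶠ q in 𝓝 x, ∀ j, q ∈ A.closedEdge j → x ∈ A.closedEdge j := by
  rw [eventually_all]
  intro j
  by_cases hx : x ∈ A.closedEdge j
  · exact Eventually.of_forall fun _ _ => hx
  · filter_upwards [isCompact_closedEdge.isClosed.isOpen_compl.mem_nhds hx] with q hq h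
    exact absurd h hq

lemma eq_of_mem_openEdge_of_mem_closedEdge (hx : x ∈ A.openEdge i) (h : x ∈ A.closedEdge j) :
    j = i := by
  rcases mem_closedEdge_iff.1 h with h | h | h
  · exact openEdge_unique h hx
  · exact absurd hx (h ▸ A.vertex_notMem_edge j i)
  · exact absurd hx (h ▸ A.vertex_notMem_edge (j + 1) i)

lemma eventually_mem_openEdge_of_level (hx : x ∈ A.openEdge i) :
    ∀ᶠ q in 𝓝 x, A.level i q = 0 → q ∈ A.openEdge i := by
  obtain ⟨-, h0, h1⟩ := mem_openEdge_iff.1 hx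
  filter_upwards [continuous_param.continuousAt.eventually (lt_mem_nhds h0),
    continuous_param.continuousAt.eventually (gt_mem_nhds h1)] with q hq0 hq1 hq
  exact mem_openEdge_iff.2 ⟨hq, hq0, hq1⟩

lemma eventually_mem_openEdge_of_mem_curve (hx : x ∈ A.openEdge i) :
    ∀ᶠ q in 𝓝 x, q ∈ A.curve → q ∈ A.openEdge i := by
  filter_upwards [eventually_mem_closedEdge (A := A) x, eventually_mem_openEdge_of_level hx]
    with q h1 h2 hq
  obtain ⟨j, hj⟩ := mem_curve_iff.1 hq
  obtain rfl := eq_of_mem_openEdge_of_mem_closedEdge hx (h1 j hj)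
  exact h2 (level_of_mem_closedEdge hj)

lemma eventually_near_vertex (i : ZMod A.n) :
    ∀ᶠ q in 𝓝 (A.vertex (i + 1)), q ∈ A.curve → q ∈ A.closedEdge i ∨ q ∈ A.closedEdge (i + 1) := by
  filter_upwards [eventually_mem_closedEdge (A := A) (A.vertex (i + 1))] with q h1 hq
  obtain ⟨j, hj⟩ := mem_curve_iff.1 hq
  rcases mem_closedEdge_iff.1 (h1 j hj) with h | h | h
  · exact absurd h (A.vertex_notMem_edge _ _)
  · rw [A.vertex_injective h]; exact Or.inr hj
  · rw [add_right_cancel (A.vertex_injective h)]; exact Or.inl hj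

lemma det_edgeVector_add_one_ne_zero (i : ZMod A.n) :
    det (A.edgeVector i) (A.edgeVector (i + 1)) ≠ 0 := by
  intro h
  obtain ⟨t, ht⟩ := exists_eq_smul_of_det_eq_zero (A.edgeVector_ne_zero i) h
  apply A.not_collinear i
  rw [collinear_iff_of_mem (p₀ := A.vertex i) (by simp)]
  refine ⟨A.edgeVector i, ?_⟩
  have e2 : A.vertex (i + 2) = A.vertex i + (1 + t) • A.edgeVector i := by
    have : (i + 2 : ZMod A.n) = i + 1 + 1 := by ring
    rw [this, vertex_add_one, vertex_add_one, ht, add_smul, one_smul, add_assoc]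
  simp only [mem_insert_iff, mem_singleton_iff, forall_eq_or_imp, forall_eq, vadd_eq_add]
  refine ⟨⟨0, by simp⟩, ⟨1, ?_⟩, ⟨1 + t, ?_⟩⟩
  · rw [vertex_add_one, one_smul, add_comm]
  · rw [e2, add_comm]

/-! ### The inside and the outside of a polygon -/

lemma inside_subset : A.inside ⊆ A.curveᶜ := fun _ h => h.1

lemma mem_inside_of_isPreconnected {K : Set Plane} (hK : IsPreconnected K) (hc : K ⊆ A.curveᶜ)
    {a b : Plane} (ha : a ∈ K) (hb : b ∈ K) (h : a ∈ A.inside) : b ∈ A.inside := by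
  refine ⟨hc hb, ?_⟩
  rw [← connectedComponentIn_eq (hK.subset_connectedComponentIn ha hc hb)]
  exact h.2

lemma component_mem_nhds (hq : q ∈ A.curveᶜ) : connectedComponentIn A.curveᶜ q ∈ 𝓝 q :=
  isClosed_curve.isOpen_compl.connectedComponentIn.mem_nhds (mem_connectedComponentIn hq)

lemma isOpen_inside : IsOpen A.inside := by
  rw [isOpen_iff_mem_nhds]
  intro q hq
  filter_upwards [component_mem_nhds hq.1] with r hr
  exact mem_inside_of_isPreconnected isPreconnected_connectedComponentIn
    (connectedComponentIn_subset _ _) (mem_connectedComponentIn hq.1) hr hq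

lemma isOpen_outside : IsOpen (A.curveᶜ \ A.inside) := by
  rw [isOpen_iff_mem_nhds]
  intro q hq
  filter_upwards [component_mem_nhds hq.1] with r hr
  refine ⟨connectedComponentIn_subset _ _ hr, fun h => hq.2 ?_⟩
  exact mem_inside_of_isPreconnected isPreconnected_connectedComponentIn
    (connectedComponentIn_subset _ _) hr (mem_connectedComponentIn hq.1) h

lemma outside_nonempty : (A.curveᶜ \ A.inside).Nonempty := by
  obtain ⟨R, hR⟩ := A.isCompact_curve.isBounded.exists_norm_le
  have hconv : Convex ℝ {q : Plane | R < q.1} :=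
    convex_halfSpace_gt ⟨fun _ _ => rfl, fun _ _ => rfl⟩ R
  have hsub : {q : Plane | R < q.1} ⊆ A.curveᶜ := by
    intro q hq hc
    have h1 := (le_abs_self q.1).trans ((norm_fst_le q).trans (hR q hc))
    exact absurd h1 (not_le.2 hq)
  have hp : ((R + 1, 0) : Plane) ∈ {q : Plane | R < q.1} := lt_add_one R
  refine ⟨(R + 1, 0), hsub hp, fun h => ?_⟩
  obtain ⟨T, hT⟩ := h.2.exists_norm_le
  have hp' : ((max R T + 1, 0) : Plane) ∈ {q : Plane | R < q.1} :=
    lt_of_le_of_lt (le_max_left R T) (lt_add_one _)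
  have h2 := hT _ (hconv.isPreconnected.subset_connectedComponentIn hp hsub hp')
  have h3 := (le_abs_self _).trans ((norm_fst_le _).trans h2)
  exact absurd h3 (not_le.2 (lt_of_le_of_lt (le_max_right R T) (lt_add_one _)))

/-! ### The winding number of a polygon around a point -/

/-- The quotient of the vectors from `p` to the ends of the `i`-th edge, as a complex number. -/
def ratio (A : Polygon) (i : ZMod A.n) (p : Plane) : ℂ :=
  Complex.equivRealProdCLM.symm (A.vertex (i + 1) - p) /
    Complex.equivRealProdCLM.symm (A.vertex i - p)

/-- The total angle under which the oriented polygon is seen from `p`, that is, `2π` times the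
winding number. -/
def totalAngle (A : Polygon) (p : Plane) : ℝ := ∑ i, (A.ratio i p).arg

lemma equivRealProdCLM_symm_ne_zero {u : Plane} (hu : u ≠ 0) :
    Complex.equivRealProdCLM.symm u ≠ 0 := by simpa using hu

lemma sub_ne_zero_of_notMem_curve {p : Plane} (hp : p ∉ A.curve) (i : ZMod A.n) :
    A.vertex i - p ≠ 0 := fun h => hp (sub_eq_zero.1 h ▸ vertex_mem_curve i)

lemma ratio_mem_slitPlane {p : Plane} (hp : p ∉ A.closedEdge i) :
    A.ratio i p ∈ Complex.slitPlane := by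
  have h0 : A.vertex i - p ≠ 0 := fun h => hp (sub_eq_zero.1 h ▸ vertex_mem_closedEdge)
  by_contra h
  rw [Complex.mem_slitPlane_iff, not_or, not_lt, not_not] at h
  set r : ℝ := -(A.ratio i p).re with hr
  have hr0 : 0 ≤ r := by linarith [h.1]
  have h1 : A.ratio i p = ((-r : ℝ) : ℂ) := by
    apply Complex.ext <;> simp [hr, h.2]
  rw [ratio, div_eq_iff (equivRealProdCLM_symm_ne_zero h0), ← Complex.real_smul,
    ← map_smul] at h1
  have h2 := Complex.equivRealProdCLM.symm.injective h1
  apply hp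
  have hpos : 0 < 1 + r := by linarith
  have h3 : (1 + r) • (p - A.vertex i) = A.edgeVector i := by
    rw [edgeVector, add_smul, one_smul]
    have h4 : r • (p - A.vertex i) = A.vertex (i + 1) - p := by
      rw [h2, ← neg_sub (A.vertex i) p, smul_neg, ← neg_smul]
    rw [h4]; abel
  rw [mem_closedEdge_iff_exists]
  refine ⟨(1 + r)⁻¹, by positivity, inv_le_one_of_one_le₀ (by linarith), ?_⟩
  rw [← h3, smul_smul, inv_mul_cancel₀ hpos.ne', one_smul]; abel

lemma continuousAt_ratio {p : Plane} (hp : A.vertex i - p ≠ 0) : ContinuousAt (A.ratio i) p := by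
  unfold ratio
  refine ContinuousAt.div ?_ ?_ (equivRealProdCLM_symm_ne_zero hp) <;> fun_prop

lemma continuousAt_arg_ratio {p : Plane} (hp : p ∉ A.closedEdge i) :
    ContinuousAt (fun p => (A.ratio i p).arg) p :=
  (Complex.continuousAt_arg (ratio_mem_slitPlane hp)).comp
    (continuousAt_ratio fun h => hp (sub_eq_zero.1 h ▸ vertex_mem_closedEdge))

lemma continuousOn_totalAngle : ContinuousOn A.totalAngle A.curveᶜ := by
  intro p hp
  refine ContinuousAt.continuousWithinAt ?_
  unfold totalAngle
  exact tendsto_finsetSum _ fun i _ =>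
    continuousAt_arg_ratio fun h => hp (closedEdge_subset_curve h)

/-- The product of the ratios telescopes to `1`, so their arguments add up to a multiple of `2π`. -/
lemma exists_totalAngle_eq {p : Plane} (hp : p ∉ A.curve) :
    ∃ m : ℤ, A.totalAngle p = m * (2 * Real.pi) := by
  have hne : ∀ i, Complex.equivRealProdCLM.symm (A.vertex i - p) ≠ 0 := fun i =>
    equivRealProdCLM_symm_ne_zero (sub_ne_zero_of_notMem_curve hp i)
  have h1 : Complex.exp (∑ i, Complex.log (A.ratio i p)) = 1 := by
    rw [Complex.exp_sum]
    have : ∀ i, Complex.exp (Complex.log (A.ratio i p)) = A.ratio i p := fun i =>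
      Complex.exp_log (div_ne_zero (hne _) (hne _))
    rw [Finset.prod_congr rfl fun i _ => this i]
    simp only [ratio, Finset.prod_div_distrib]
    rw [div_eq_one_iff_eq (Finset.prod_ne_zero_iff.2 fun i _ => hne i)]
    exact Equiv.prod_comp (Equiv.addRight (1 : ZMod A.n))
      (fun i => Complex.equivRealProdCLM.symm (A.vertex i - p))
  obtain ⟨m, hm⟩ := Complex.exp_eq_one_iff.1 h1
  refine ⟨m, ?_⟩
  have := congrArg Complex.im hm
  rw [Complex.im_sum] at this
  simpa [totalAngle, Complex.log_im] using this

lemma totalAngle_eq_of_isPreconnected {K : Set Plane} (hK : IsPreconnected K) (hc : K ⊆ A.curveᶜ)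
    {a b : Plane} (ha : a ∈ K) (hb : b ∈ K) : A.totalAngle a = A.totalAngle b := by
  have hex : ∀ p, ∃ m : ℤ, p ∉ A.curve → A.totalAngle p = m * (2 * Real.pi) := by
    intro p
    by_cases hp : p ∈ A.curve
    · exact ⟨0, fun h => absurd hp h⟩
    · obtain ⟨m, hm⟩ := exists_totalAngle_eq hp
      exact ⟨m, fun _ => hm⟩
  choose f hf using hex
  have hpi := Real.two_pi_pos.ne'
  have hcont : ContinuousOn f K := by
    rw [Int.isClosedEmbedding_coe_real.isInducing.continuousOn_iff]
    refine ((continuousOn_totalAngle.mono hc).div_const (2 * Real.pi)).congr fun p hp => ?_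
    rw [Function.comp_apply, eq_div_iff hpi, ← hf p (hc hp)]
  rw [hf a (hc ha), hf b (hc hb), hK.constant hcont ha hb]

lemma tendsto_ratio_cobounded : Tendsto (A.ratio i) (Bornology.cobounded Plane) (𝓝 1) := by
  have h1 : Tendsto (fun p => Complex.equivRealProdCLM.symm (A.vertex i - p))
      (Bornology.cobounded Plane) (Bornology.cobounded ℂ) := by
    refine Complex.equivRealProdCLM.symm.antilipschitz.tendsto_cobounded.comp ?_
    rw [tendsto_norm_atTop_iff_cobounded.symm]
    refine tendsto_atTop_mono (fun p => ?_)
      (tendsto_atTop_add_const_right _ (-‖A.vertex i‖) tendsto_norm_cobounded_atTop)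
    have := norm_sub_norm_le p (A.vertex i)
    rw [norm_sub_rev] at this
    linarith
  have h2 : Tendsto (fun p => 1 + Complex.equivRealProdCLM.symm (A.edgeVector i) *
      (Complex.equivRealProdCLM.symm (A.vertex i - p))⁻¹) (Bornology.cobounded Plane) (𝓝 1) := by
    have := (tendsto_const_nhds (x := Complex.equivRealProdCLM.symm (A.edgeVector i))).mul
      (tendsto_inv₀_cobounded.comp h1)
    simpa using this.const_add 1
  refine h2.congr' ?_
  have h3 : ∀ᶠ p in Bornology.cobounded Plane, p ∉ ({A.vertex i} : Set Plane) :=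
    (Bornology.isBounded_singleton (x := A.vertex i))
  filter_upwards [h3] with p hp
  have hne := equivRealProdCLM_symm_ne_zero (sub_ne_zero.2 fun h => hp h.symm)
  rw [ratio, eq_div_iff hne, add_mul, one_mul, mul_assoc, inv_mul_cancel₀ hne, mul_one, ← map_add,
    vertex_add_one]
  congr 1; abel

/-- Far away the polygon is seen under a small angle, which vanishes, being a multiple of `2π`. -/
lemma totalAngle_eq_zero_of_outside {p : Plane} (hp : p ∉ A.curve) (h : p ∉ A.inside) :
    A.totalAngle p = 0 := by
  have h1 : Tendsto A.totalAngle (Bornology.cobounded Plane) (𝓝 0) := by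
    have : (0 : ℝ) = ∑ i : ZMod A.n, (1 : ℂ).arg := by simp
    rw [this]
    exact tendsto_finsetSum _ fun i _ =>
      (Complex.continuousAt_arg Complex.one_mem_slitPlane).tendsto.comp tendsto_ratio_cobounded
  have h2 : ∀ᶠ q in Bornology.cobounded Plane, |A.totalAngle q| < 1 := by
    filter_upwards [h1.eventually (Metric.ball_mem_nhds 0 one_pos)] with q hq
    simpa using hq
  have h3 : ¬ connectedComponentIn A.curveᶜ p ⊆ {q | ¬ |A.totalAngle q| < 1} := fun hs =>
    h ⟨hp, Bornology.IsBounded.subset (by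
      rw [Bornology.isBounded_def]; filter_upwards [h2] with q hq hq'; exact hq' hq) hs⟩
  obtain ⟨q, hq, hq1⟩ := not_subset.1 h3
  rw [mem_ofPred_eq, not_not] at hq1
  rw [totalAngle_eq_of_isPreconnected isPreconnected_connectedComponentIn
    (connectedComponentIn_subset _ _) (mem_connectedComponentIn hp) hq]
  obtain ⟨m, hm⟩ := exists_totalAngle_eq (connectedComponentIn_subset _ _ hq)
  rw [hm] at hq1 ⊢
  have hm0 : m = 0 := by
    by_contra hm0
    have h4 : (1 : ℝ) ≤ |(m : ℝ)| := by exact_mod_cast Int.one_le_abs hm0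
    rw [abs_mul, abs_of_pos Real.two_pi_pos] at hq1
    nlinarith [Real.pi_gt_three]
  simp [hm0]

lemma ratio_im (q : Plane) : (A.ratio i q).im =
    A.level i q / Complex.normSq (Complex.equivRealProdCLM.symm (A.vertex i - q)) := by
  rw [ratio, Complex.div_im, ← sub_div]
  congr 1
  simp [level, det, edgeVector]
  ring

lemma ratio_of_mem_openEdge (hx : x ∈ A.openEdge i) :
    (A.ratio i x).re < 0 ∧ (A.ratio i x).im = 0 := by
  refine ⟨?_, by rw [ratio_im, (mem_openEdge_iff.1 hx).1, zero_div]⟩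
  obtain ⟨s, h0, h1, rfl⟩ := mem_openEdge_iff_exists.1 hx
  have h2 : A.vertex (i + 1) - (A.vertex i + s • A.edgeVector i) = (1 - s) • A.edgeVector i := by
    rw [vertex_add_one, sub_smul, one_smul]; abel
  have h3 : A.vertex i - (A.vertex i + s • A.edgeVector i) = (-s) • A.edgeVector i := by
    rw [neg_smul]; abel
  have hne := equivRealProdCLM_symm_ne_zero (A.edgeVector_ne_zero i)
  have h4 : A.ratio i (A.vertex i + s • A.edgeVector i) = (((1 - s) / (-s) : ℝ) : ℂ) := by
    rw [ratio, h2, h3, map_smul, map_smul, Complex.real_smul, Complex.real_smul,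
      mul_div_mul_right _ _ hne, Complex.ofReal_div]
  rw [h4, Complex.ofReal_re]
  exact div_neg_of_pos_of_neg (by linarith) (by linarith)

/-! ### The two sides of an edge -/

lemma frequently_side (hx : A.level i x = 0) {ε : ℝ} (hε : ε ≠ 0) :
    ∃ᶠ q in 𝓝 x, 0 < ε * A.level i q := by
  set d : Plane := ε • (-(A.edgeVector i).2, (A.edgeVector i).1) with hd
  have hdet : 0 < ε * det (A.edgeVector i) d := by
    have h1 := sq_add_sq_pos (A.edgeVector_ne_zero i)
    have h2 := mul_self_pos.2 hε
    have : ε * det (A.edgeVector i) d = (ε * ε) * ((A.edgeVector i).1 * (A.edgeVector i).1 +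
        (A.edgeVector i).2 * (A.edgeVector i).2) := by simp [hd, det]; ring
    rw [this]; positivity
  have ht : Tendsto (fun t : ℝ => x + t • d) (𝓝[>] 0) (𝓝 x) := by
    have : ContinuousAt (fun t : ℝ => x + t • d) 0 := by fun_prop
    simpa using this.tendsto.mono_left nhdsWithin_le_nhds
  refine ht.frequently (Eventually.frequently ?_)
  filter_upwards [self_mem_nhdsWithin] with t ht
  rw [level_add_smul, hx, zero_add, mul_left_comm]
  exact mul_pos ht hdet

/-- The two sides of an open edge cannot both be outside, since the winding number jumps by one
across the edge. -/
lemma not_both_sides_outside (hx : x ∈ A.openEdge i)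
    (h1 : ∀ᶠ q in 𝓝 x, 0 < A.level i q → q ∉ A.inside)
    (h2 : ∀ᶠ q in 𝓝 x, A.level i q < 0 → q ∉ A.inside) : False := by
  have hlev := (mem_openEdge_iff.1 hx).1
  have hoff : ∀ᶠ q in 𝓝 x, A.level i q ≠ 0 → q ∉ A.curve := by
    filter_upwards [eventually_mem_openEdge_of_mem_curve hx] with q hq hne hc
    exact hne (mem_openEdge_iff.1 (hq hc)).1
  have hcr : ContinuousAt (A.ratio i) x := by
    refine continuousAt_ratio fun h => ?_
    exact notMem_vertices_of_mem_openEdge hx ⟨i, sub_eq_zero.1 h⟩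
  set F : Plane → ℝ := fun q => ∑ j ∈ Finset.univ.erase i, (A.ratio j q).arg
  have hF : Tendsto F (𝓝 x) (𝓝 (F x)) :=
    tendsto_finsetSum _ fun j hj => continuousAt_arg_ratio fun hc =>
      (Finset.ne_of_mem_erase hj) (eq_of_mem_openEdge_of_mem_closedEdge hx hc)
  have hsum : ∀ q, A.totalAngle q = (A.ratio i q).arg + F q := fun q =>
    (Finset.add_sum_erase _ _ (Finset.mem_univ i)).symm
  obtain ⟨hre, him⟩ := ratio_of_mem_openEdge hx
  have key : ∀ (s : Set Plane) (T : Set ℂ) (c : ℝ), (∃ᶠ q in 𝓝 x, q ∈ s) →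
      (∀ᶠ q in 𝓝 x, q ∈ s → A.totalAngle q = 0) → (∀ q ∈ s, A.ratio i q ∈ T) →
      Tendsto Complex.arg (𝓝[T] (A.ratio i x)) (𝓝 c) → c + F x = 0 := by
    intro s T c hs h0 hT hc
    have : (𝓝[s] x).NeBot := by
      rw [← mem_closure_iff_nhdsWithin_neBot, mem_closure_iff_frequently]; exact hs
    have t1 : Tendsto (fun q => (A.ratio i q).arg) (𝓝[s] x) (𝓝 c) := by
      refine hc.comp (tendsto_nhdsWithin_iff.2 ⟨hcr.tendsto.mono_left nhdsWithin_le_nhds, ?_⟩)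
      filter_upwards [self_mem_nhdsWithin] with q hq using hT q hq
    have t2 := t1.add (hF.mono_left (nhdsWithin_le_nhds (s := s)))
    refine tendsto_nhds_unique (t2.congr' ?_) tendsto_const_nhds
    filter_upwards [self_mem_nhdsWithin, nhdsWithin_le_nhds h0] with q hq hq0
    rw [← hsum, hq0 hq]
  have k1 := key {q | 0 < A.level i q} {z | 0 ≤ z.im} Real.pi
    (by simpa using frequently_side hlev one_ne_zero)
    (by filter_upwards [h1, hoff] with q a b hq
        exact totalAngle_eq_zero_of_outside (b (ne_of_gt hq)) (a hq))
    (fun q hq => by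
      rw [mem_ofPred_eq, ratio_im]; exact div_nonneg (le_of_lt hq) (Complex.normSq_nonneg _))
    (Complex.tendsto_arg_nhdsWithin_im_nonneg_of_re_neg_of_im_zero hre him)
  have k2 := key {q | A.level i q < 0 ∧ q ≠ A.vertex i} {z | z.im < 0} (-Real.pi)
    (by
      have := (frequently_side (A := A) (x := x) hlev (neg_ne_zero.2 (one_ne_zero (α := ℝ))))
      refine this.mono fun q hq => ?_
      have hq' : A.level i q < 0 := by linarith
      exact ⟨hq', fun h => by rw [h, level_vertex] at hq'; exact lt_irrefl _ hq'⟩)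
    (by filter_upwards [h2, hoff] with q a b hq
        exact totalAngle_eq_zero_of_outside (b (ne_of_lt hq.1)) (a hq.1))
    (fun q hq => by
      rw [mem_ofPred_eq, ratio_im]
      exact div_neg_of_neg_of_pos hq.1 (Complex.normSq_pos.2
        (equivRealProdCLM_symm_ne_zero (sub_ne_zero.2 hq.2.symm))))
    (Complex.tendsto_arg_nhdsWithin_im_neg_of_re_neg_of_im_zero hre him)
  linarith [Real.pi_pos]

lemma convex_side (ε : ℝ) : Convex ℝ {q | 0 < ε * A.level i q} := by
  intro q hq q' hq' a b ha hb hab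
  have h : ε * A.level i (a • q + b • q') =
      a • (ε * A.level i q) + b • (ε * A.level i q') := by
    have : A.vertex i = a • A.vertex i + b • A.vertex i := by rw [← add_smul, hab, one_smul]
    have h2 : a • q + b • q' - A.vertex i = a • (q - A.vertex i) + b • (q' - A.vertex i) := by
      rw [smul_sub, smul_sub]; nth_rewrite 1 [this]; abel
    simp only [level, h2, det_add_right, det_smul_right, smul_eq_mul]; ring
  rw [mem_ofPred_eq, h]
  exact convex_Ioi (0 : ℝ) hq hq' ha hb hab

lemma side_inside_or_outside (hx : x ∈ A.openEdge i) (ε : ℝ) :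
    (∀ᶠ q in 𝓝 x, 0 < ε * A.level i q → q ∈ A.inside) ∨
      ∀ᶠ q in 𝓝 x, 0 < ε * A.level i q → q ∉ A.inside := by
  obtain ⟨r, hr, hball⟩ :=
    Metric.eventually_nhds_iff_ball.1 (eventually_mem_openEdge_of_mem_curve hx)
  set H := Metric.ball x r ∩ {q | 0 < ε * A.level i q}
  have hH : IsPreconnected H := ((convex_ball x r).inter (convex_side ε)).isPreconnected
  have hc : H ⊆ A.curveᶜ := by
    rintro q ⟨hq, hq'⟩ hqc
    rw [mem_ofPred_eq, (mem_openEdge_iff.1 (hball q hq hqc)).1, mul_zero] at hq'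
    exact lt_irrefl _ hq'
  by_cases h : ∃ q ∈ H, q ∈ A.inside
  · obtain ⟨q, hq, hqi⟩ := h
    left
    filter_upwards [Metric.ball_mem_nhds x hr] with q' hq' hpos
    exact mem_inside_of_isPreconnected hH hc hq ⟨hq', hpos⟩ hqi
  · right
    filter_upwards [Metric.ball_mem_nhds x hr] with q' hq' hpos hin
    exact h ⟨q', ⟨hq', hpos⟩, hin⟩

/-- Being outside is constant along each side of an open edge. -/
lemma side_outside_along {ε : ℝ} (hε : ε ≠ 0) {y : Plane} (hx : x ∈ A.openEdge i)
    (hy : y ∈ A.openEdge i) (h : ∀ᶠ q in 𝓝 x, 0 < ε * A.level i q → q ∉ A.inside) :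
    ∀ᶠ q in 𝓝 y, 0 < ε * A.level i q → q ∉ A.inside := by
  rcases side_inside_or_outside hy ε with hin | hout
  swap
  · exact hout
  exfalso
  have hpre : IsPreconnected (A.openEdge i) := (convex_openSegment _ _).isPreconnected
  have ho1 : IsOpen {z | ∀ᶠ q in 𝓝 z, 0 < ε * A.level i q → q ∉ A.inside} :=
    isOpen_iff_mem_nhds.2 fun z hz => hz.eventually_nhds
  have ho2 : IsOpen {z | ∀ᶠ q in 𝓝 z, 0 < ε * A.level i q → q ∈ A.inside} :=
    isOpen_iff_mem_nhds.2 fun z hz => hz.eventually_nhds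
  obtain ⟨z, hz, hz1, hz2⟩ := hpre _ _ ho1 ho2
    (fun z hz => (side_inside_or_outside hz ε).symm) ⟨x, hx, h⟩ ⟨y, hy, hin⟩
  obtain ⟨q, hq, hq1, hq2⟩ := ((frequently_side (mem_openEdge_iff.1 hz).1 hε).and_eventually
    (hz1.and hz2)).exists
  exact hq1 hq (hq2 hq)

/-- Near the common vertex of two consecutive edges, their sides with the same orientation lie in a
connected set which avoids the curve: the intersection or the union of two half discs, depending on
the direction in which the polygon turns. -/
lemma exists_isPreconnected_corner (i : ZMod A.n) {ε : ℝ} (hε : ε ≠ 0) :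
    ∃ x ∈ A.openEdge i, ∃ y ∈ A.openEdge (i + 1), ∃ K : Set Plane, IsPreconnected K ∧
      K ⊆ A.curveᶜ ∧ (∀ᶠ q in 𝓝 x, 0 < ε * A.level i q → q ∈ K) ∧
      ∀ᶠ q in 𝓝 y, 0 < ε * A.level (i + 1) q → q ∈ K := by
  obtain ⟨r, hr, hball⟩ := Metric.eventually_nhds_iff_ball.1 (eventually_near_vertex i)
  set v := A.vertex (i + 1) with hv
  set e := A.edgeVector i with he
  set f := A.edgeVector (i + 1) with hf
  set D := det e f with hD
  have hD0 : D ≠ 0 := det_edgeVector_add_one_ne_zero i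
  have hDfe : det f e = -D := det_comm f e
  have hv0 : A.level i v = 0 := by
    have := level_on_line (A := A) (i := i) 1
    rwa [one_smul, ← vertex_add_one] at this
  have hv1 : A.level (i + 1) v = 0 := level_vertex
  have hl0 : ∀ (t : ℝ) d, A.level i (v + t • d) = t * det e d := fun t d => by
    rw [level_add_smul, hv0, zero_add]
  have hl1 : ∀ (t : ℝ) d, A.level (i + 1) (v + t • d) = t * det f d := fun t d => by
    rw [level_add_smul, hv1, zero_add]
  have hvi : A.vertex i = v + (-1 : ℝ) • e := by rw [hv, vertex_add_one, he]; simp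
  have hnear : ∀ d : Plane, ∀ᶠ t : ℝ in 𝓝[>] 0, v + t • d ∈ Metric.ball v r := by
    intro d
    have hc : ContinuousAt (fun t : ℝ => v + t • d) 0 := by fun_prop
    have := hc.tendsto
    simp only [zero_smul, add_zero] at this
    exact nhdsWithin_le_nhds (this (Metric.ball_mem_nhds v hr))
  have hlt1 : ∀ᶠ t : ℝ in 𝓝[>] 0, t < 1 := nhdsWithin_le_nhds (gt_mem_nhds one_pos)
  obtain ⟨t, ht1, htx, hty, htw, ht0⟩ := (hlt1.and ((hnear (-e)).and ((hnear f).and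
    ((hnear ((ε * D) • (f - e))).and self_mem_nhdsWithin)))).exists
  have ht0 : 0 < t := ht0
  set x := v + t • (-e) with hx
  set y := v + t • f with hy
  set w := v + t • (ε * D) • (f - e) with hw
  have hxe : x ∈ A.openEdge i := by
    refine mem_openEdge_iff_exists.2 ⟨1 - t, by linarith, by linarith, ?_⟩
    rw [hvi, hx, add_assoc, ← add_smul, smul_neg, ← neg_smul]; congr 2; ring
  have hye : y ∈ A.openEdge (i + 1) := mem_openEdge_iff_exists.2 ⟨t, ht0, ht1, rfl⟩
  have lx : A.level (i + 1) x = t * D := by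
    rw [hx, hl1, ← neg_one_smul ℝ e, det_smul_right, hDfe]; ring
  have ly : A.level i y = t * D := by rw [hy, hl0]
  -- On the closed edges at `v`, the level function of the other edge has the sign of `D`.
  have sgn0 : ∀ q ∈ A.closedEdge i, ∃ s, 0 ≤ s ∧ A.level (i + 1) q = s * D := by
    intro q hq
    obtain ⟨s, -, hs, rfl⟩ := mem_closedEdge_iff_exists.1 hq
    refine ⟨1 - s, by linarith, ?_⟩
    rw [hvi, add_assoc, ← add_smul, hl1, hDfe]; ring
  have sgn1 : ∀ q ∈ A.closedEdge (i + 1), ∃ s, 0 ≤ s ∧ A.level i q = s * D := by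
    intro q hq
    obtain ⟨s, hs, -, rfl⟩ := mem_closedEdge_iff_exists.1 hq
    exact ⟨s, hs, hl0 _ _⟩
  set H0 := Metric.ball v r ∩ {q | 0 < ε * A.level i q} with hH0
  set H1 := Metric.ball v r ∩ {q | 0 < ε * A.level (i + 1) q} with hH1
  have c0 : Convex ℝ H0 := (convex_ball v r).inter (convex_side ε)
  have c1 : Convex ℝ H1 := (convex_ball v r).inter (convex_side ε)
  have wpos : 0 < ε * (t * (ε * D * D)) := by
    have h1 := mul_self_pos.2 hε
    have h2 := mul_self_pos.2 hD0
    have : ε * (t * (ε * D * D)) = t * ((ε * ε) * (D * D)) := by ring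
    rw [this]; positivity
  have w0 : w ∈ H0 := ⟨htw, by
    rw [mem_ofPred_eq, hw, hl0, det_smul_right, det_sub_right, det_self, sub_zero]; exact wpos⟩
  have w1 : w ∈ H1 := ⟨htw, by
    rw [mem_ofPred_eq, hw, hl1, det_smul_right, det_sub_right, det_self, hDfe, zero_sub, neg_neg]
    exact wpos⟩
  have bx : ∀ᶠ q in 𝓝 x, q ∈ Metric.ball v r := Metric.isOpen_ball.mem_nhds htx
  have hyb : ∀ᶠ q in 𝓝 y, q ∈ Metric.ball v r := Metric.isOpen_ball.mem_nhds hty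
  have hnot : ∀ (k : ZMod A.n) q, 0 < ε * A.level k q → q ∉ A.closedEdge k := by
    intro k q hq hc
    rw [level_of_mem_closedEdge hc, mul_zero] at hq
    exact lt_irrefl _ hq
  rcases lt_or_gt_of_ne (mul_ne_zero hε hD0) with hneg | hpos
  · refine ⟨x, hxe, y, hye, H0 ∪ H1, c0.isPreconnected.union w w0 w1 c1.isPreconnected, ?_, ?_, ?_⟩
    · rintro q (⟨hq, hq'⟩ | ⟨hq, hq'⟩) hc
      · rcases hball q hq hc with h | h
        · exact hnot _ _ hq' h
        · obtain ⟨s, hs, hs'⟩ := sgn1 q h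
          rw [mem_ofPred_eq, hs'] at hq'
          nlinarith
      · rcases hball q hq hc with h | h
        · obtain ⟨s, hs, hs'⟩ := sgn0 q h
          rw [mem_ofPred_eq, hs'] at hq'
          nlinarith
        · exact hnot _ _ hq' h
    · filter_upwards [bx] with q hq h using Or.inl ⟨hq, h⟩
    · filter_upwards [hyb] with q hq h using Or.inr ⟨hq, h⟩
  · refine ⟨x, hxe, y, hye, H0 ∩ H1, (c0.inter c1).isPreconnected, ?_, ?_, ?_⟩
    · rintro q ⟨⟨hq, hq0⟩, -, hq1⟩ hc
      rcases hball q hq hc with h | h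
      · exact hnot _ _ hq0 h
      · exact hnot _ _ hq1 h
    · have : ContinuousAt (fun q => ε * A.level (i + 1) q) x :=
        (continuous_const.mul continuous_level).continuousAt
      have hp : 0 < ε * A.level (i + 1) x := by rw [lx]; nlinarith
      filter_upwards [bx, this.eventually (lt_mem_nhds hp)] with q hq h h'
      exact ⟨⟨hq, h'⟩, hq, h⟩
    · have : ContinuousAt (fun q => ε * A.level i q) y :=
        (continuous_const.mul continuous_level).continuousAt
      have hp : 0 < ε * A.level i y := by rw [ly]; nlinarith
      filter_upwards [hyb, this.eventually (lt_mem_nhds hp)] with q hq h h'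
      exact ⟨⟨hq, h⟩, hq, h'⟩

lemma side_outside_next {ε : ℝ} (hε : ε ≠ 0)
    (h : ∀ x ∈ A.openEdge i, ∀ᶠ q in 𝓝 x, 0 < ε * A.level i q → q ∉ A.inside) :
    ∀ x ∈ A.openEdge (i + 1), ∀ᶠ q in 𝓝 x, 0 < ε * A.level (i + 1) q → q ∉ A.inside := by
  intro z hz
  obtain ⟨x, hx, y, hy, K, hK, hKc, hxK, hyK⟩ := exists_isPreconnected_corner i hε
  refine side_outside_along hε hy hz ((side_inside_or_outside hy ε).resolve_left fun hin => ?_)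
  obtain ⟨p, hp, hp1, hp2⟩ := ((frequently_side (mem_openEdge_iff.1 hx).1 hε).and_eventually
    ((h x hx).and hxK)).exists
  obtain ⟨q, hq, hq1, hq2⟩ := ((frequently_side (mem_openEdge_iff.1 hy).1 hε).and_eventually
    (hin.and hyK)).exists
  exact hp1 hp (mem_inside_of_isPreconnected hK hKc (hq2 hq) (hp2 hp) (hq1 hq))

/-- Some side of some edge is outside, since the plane without the vertices is connected. -/
lemma exists_side_outside (A : Polygon) : ∃ ε : ℝ, ε ≠ 0 ∧ ∃ i, ∃ x ∈ A.openEdge i,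
    ∀ᶠ q in 𝓝 x, 0 < ε * A.level i q → q ∉ A.inside := by
  by_contra hcon
  have hin : ∀ ε : ℝ, ε ≠ 0 → ∀ i, ∀ x ∈ A.openEdge i,
      ∀ᶠ q in 𝓝 x, 0 < ε * A.level i q → q ∈ A.inside := fun ε hε i x hx =>
    (side_inside_or_outside hx ε).resolve_right fun h => hcon ⟨ε, hε, i, x, hx, h⟩
  have hV : IsPreconnected (A.vertices)ᶜ :=
    (Set.Countable.isConnected_compl_of_one_lt_rank (by simp; norm_num)
      A.finite_vertices.countable).isPreconnected
  have ho : IsOpen (A.inside ∪ ⋃ i, A.openEdge i) := by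
    rw [isOpen_iff_mem_nhds]
    rintro x (hx | hx)
    · filter_upwards [isOpen_inside.mem_nhds hx] with q hq using Or.inl hq
    · obtain ⟨i, hi⟩ := mem_iUnion.1 hx
      filter_upwards [hin 1 one_ne_zero i x hi, hin (-1) (by norm_num) i x hi,
        eventually_mem_openEdge_of_level hi] with q h1 h2 h3
      rcases lt_trichotomy (A.level i q) 0 with h | h | h
      · exact Or.inl (h2 (by linarith))
      · exact Or.inr (mem_iUnion.2 ⟨i, h3 h⟩)
      · exact Or.inl (h1 (by linarith))
  obtain ⟨p, hp⟩ := A.outside_nonempty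
  have hmid : A.vertex 0 + (1 / 2 : ℝ) • A.edgeVector 0 ∈ A.openEdge 0 :=
    mem_openEdge_iff_exists.2 ⟨1 / 2, by norm_num, by norm_num, rfl⟩
  obtain ⟨z, -, hz1, hz2⟩ := hV _ _ ho A.isOpen_outside (fun q hq => by
      by_cases hc : q ∈ A.curve
      · exact Or.inl (Or.inr (mem_iUnion.2 (exists_mem_openEdge hc hq)))
      · by_cases hi : q ∈ A.inside
        · exact Or.inl (Or.inl hi)
        · exact Or.inr ⟨hc, hi⟩)
    ⟨_, notMem_vertices_of_mem_openEdge hmid, Or.inr (mem_iUnion.2 ⟨0, hmid⟩)⟩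
    ⟨p, fun h => hp.1 (vertices_subset_curve h), hp⟩
  rcases hz1 with h | h
  · exact hz2.2 h
  · obtain ⟨i, hi⟩ := mem_iUnion.1 h
    exact hz2.1 (openEdge_subset_curve hi)

/-- The local form of the Jordan curve theorem: with a suitable orientation, the left side of every
open edge lies inside the polygon and the right side does not. -/
theorem exists_orientation (A : Polygon) : ∃ ε : ℝ, ε ≠ 0 ∧ ∀ i, ∀ x ∈ A.openEdge i,
    (∀ᶠ q in 𝓝 x, 0 < ε * A.level i q → q ∈ A.inside) ∧
      ∀ᶠ q in 𝓝 x, ε * A.level i q < 0 → q ∉ A.inside := by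
  obtain ⟨ε, hε, i₀, x₀, hx₀, h₀⟩ := A.exists_side_outside
  have hall : ∀ k : ℕ, ∀ x ∈ A.openEdge (i₀ + k),
      ∀ᶠ q in 𝓝 x, 0 < ε * A.level (i₀ + k) q → q ∉ A.inside := by
    intro k
    induction k with
    | zero =>
      rw [Nat.cast_zero, add_zero]
      exact fun x hx => side_outside_along hε hx₀ hx h₀
    | succ k ih =>
      rw [Nat.cast_succ, ← add_assoc]
      exact side_outside_next hε ih
  refine ⟨-ε, neg_ne_zero.2 hε, fun i x hx => ?_⟩
  have hi : i₀ + ((i - i₀).val : ZMod A.n) = i := by simp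
  have hout : ∀ᶠ q in 𝓝 x, 0 < ε * A.level i q → q ∉ A.inside := by
    have := hall (i - i₀).val
    rw [hi] at this
    exact this x hx
  refine ⟨(side_inside_or_outside hx (-ε)).resolve_right fun hout' => ?_, ?_⟩
  · rcases lt_or_gt_of_ne hε with h | h
    · refine not_both_sides_outside hx ?_ ?_
      · filter_upwards [hout'] with q hq hl using hq (by nlinarith)
      · filter_upwards [hout] with q hq hl using hq (by nlinarith)
    · refine not_both_sides_outside hx ?_ ?_
      · filter_upwards [hout] with q hq hl using hq (by nlinarith)
      · filter_upwards [hout'] with q hq hl using hq (by nlinarith)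
  · filter_upwards [hout] with q hq hl using hq (by linarith)

variable {k : ZMod A.n} {z d : Plane}

/-! ### Chords of a polygon in a given direction -/

/-- `z` is the other end of a chord through the inside of `A` that starts at `x` and has
direction `± d`. -/
def IsChord (A : Polygon) (x d z : Plane) : Prop :=
  z ∈ A.curve ∧ z ≠ x ∧ (∃ t : ℝ, z = x + t • d) ∧ openSegment ℝ x z ⊆ A.inside

lemma IsChord.symm (h : A.IsChord x d z) (hx : x ∈ A.curve) : A.IsChord z d x := by
  obtain ⟨-, hne, ⟨t, ht⟩, hs⟩ := h
  refine ⟨hx, hne.symm, ⟨-t, by rw [ht]; simp⟩, ?_⟩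
  rwa [openSegment_symm]

lemma tendsto_add_smul (x d : Plane) (l : Filter ℝ) (hl : l ≤ 𝓝 0) :
    Tendsto (fun t : ℝ => x + t • d) l (𝓝 x) := by
  have : ContinuousAt (fun t : ℝ => x + t • d) 0 := by fun_prop
  simpa using this.tendsto.mono_left hl

/-- A chord is not parallel to the edge at which it starts. -/
lemma IsChord.det_ne_zero (h : A.IsChord x d z) (hx : x ∈ A.openEdge i) :
    det (A.edgeVector i) d ≠ 0 := by
  intro h0
  obtain ⟨-, hne, ⟨t, rfl⟩, hs⟩ := h
  have h1 : ∀ᶠ τ : ℝ in 𝓝[>] 0, τ < 1 := nhdsWithin_le_nhds (gt_mem_nhds one_pos)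
  have h2 := (tendsto_add_smul x (t • d) (𝓝[>] 0) nhdsWithin_le_nhds).eventually
    (eventually_mem_openEdge_of_level hx)
  obtain ⟨τ, hτ1, hτ2, hτ0⟩ := (h1.and (h2.and self_mem_nhdsWithin)).exists
  refine inside_subset (hs ?_) (openEdge_subset_curve (hτ2 ?_))
  · rw [openSegment_eq_add_smul]
    exact ⟨τ, ⟨hτ0, hτ1⟩, by simp⟩
  · rw [level_add_smul, det_smul_right, h0, (mem_openEdge_iff.1 hx).1]; simp

lemma IsChord.smul_iff {c : ℝ} (hc : c ≠ 0) : A.IsChord x (c • d) z ↔ A.IsChord x d z := by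
  unfold IsChord
  have : (∃ t : ℝ, z = x + t • c • d) ↔ ∃ t : ℝ, z = x + t • d := by
    constructor
    · rintro ⟨t, rfl⟩; exact ⟨t * c, by rw [smul_smul]⟩
    · rintro ⟨t, rfl⟩; exact ⟨t / c, by rw [smul_smul, div_mul_cancel₀ _ hc]⟩
  rw [this]

/-- From a point of an open edge, exactly one chord starts in a given transversal direction. -/
theorem existsUnique_isChord (hx : x ∈ A.openEdge i) (hd : det (A.edgeVector i) d ≠ 0) :
    ∃! z, A.IsChord x d z := by
  obtain ⟨ε, hε, hA⟩ := A.exists_orientation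
  obtain ⟨hin, hout⟩ := hA i x hx
  -- After rescaling the direction points to the inside.
  set c := ε * det (A.edgeVector i) d with hc
  have hc0 : c ≠ 0 := mul_ne_zero hε hd
  suffices ∃! z, A.IsChord x (c • d) z by simpa only [IsChord.smul_iff hc0] using this
  set d' := c • d with hd'
  have hlev : ∀ t : ℝ, ε * A.level i (x + t • d') = t * (c * c) := by
    intro t
    rw [level_add_smul, (mem_openEdge_iff.1 hx).1, hd', det_smul_right]
    rw [hc]; ring
  have hcc : 0 < c * c := mul_self_pos.2 hc0
  have hd0 : d' ≠ 0 := by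
    intro h
    have h2 := hlev 1
    rw [h, smul_zero, add_zero, (mem_openEdge_iff.1 hx).1] at h2
    linarith
  obtain ⟨δ, hδ, hball⟩ := Metric.eventually_nhds_iff.1
    ((tendsto_add_smul x d' (𝓝 0) le_rfl).eventually (hin.and hout))
  have hpos : ∀ t, 0 < t → t < δ → x + t • d' ∈ A.inside := fun t h0 h1 =>
    (hball (by simpa [abs_of_pos h0] using h1)).1 (by rw [hlev]; positivity)
  have hneg : ∀ t, t < 0 → -δ < t → x + t • d' ∉ A.inside := fun t h0 h1 =>
    (hball (by rw [Real.dist_eq, sub_zero, abs_of_neg h0]; linarith)).2 (by rw [hlev]; nlinarith)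
  have hconv : ∀ s : Set ℝ, s.OrdConnected → IsPreconnected ((fun t : ℝ => x + t • d') '' s) :=
    fun s hs => hs.isPreconnected.image _ (by fun_prop)
  have hseg : ∀ t : ℝ, openSegment ℝ x (x + t • d') =
      (fun τ : ℝ => x + (τ * t) • d') '' Ioo 0 1 := by
    intro t; rw [openSegment_eq_add_smul]; simp [smul_smul]
  have hhalf : x + (δ / 2) • d' ∈ A.inside := hpos _ (by positivity) (by linarith)
  set T : Set ℝ := {t | δ ≤ t ∧ x + t • d' ∈ A.curve} with hT
  have hTne : T.Nonempty := by
    by_contra hemp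
    rw [not_nonempty_iff_eq_empty] at hemp
    have hsub : (fun t : ℝ => x + t • d') '' Ioi 0 ⊆ A.curveᶜ := by
      rintro _ ⟨t, ht, rfl⟩ hcur
      rcases lt_or_ge t δ with h | h
      · exact inside_subset (hpos t ht h) hcur
      · exact (hemp ▸ (show t ∈ T from ⟨h, hcur⟩) : t ∈ (∅ : Set ℝ))
    have hcomp := (hconv _ ordConnected_Ioi).subset_connectedComponentIn
      ⟨δ / 2, half_pos hδ, rfl⟩ hsub
    obtain ⟨R, hR⟩ := (hhalf.2.subset hcomp).exists_norm_le
    have hn : 0 < ‖d'‖ := norm_pos_iff.2 hd0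
    set t := (|R| + ‖x‖ + 1) / ‖d'‖ with ht
    have ht0 : 0 < t := by positivity
    have h1 := hR _ ⟨t, ht0, rfl⟩
    have h2 : ‖t • d'‖ = |R| + ‖x‖ + 1 := by
      rw [norm_smul, Real.norm_of_nonneg ht0.le, ht, div_mul_cancel₀ _ hn.ne']
    have h3 := norm_sub_le (x + t • d') x
    rw [add_sub_cancel_left, h2] at h3
    linarith [le_abs_self R]
  have hTcl : IsClosed T := by
    refine isClosed_Ici.inter (A.isClosed_curve.preimage (f := fun t : ℝ => x + t • d') ?_)
    fun_prop
  have hTb : BddBelow T := ⟨δ, fun t ht => ht.1⟩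
  set t₁ := sInf T
  obtain ⟨ht1, ht2⟩ : t₁ ∈ T := hTcl.csInf_mem hTne hTb
  have ht0 : 0 < t₁ := hδ.trans_le ht1
  have hsub : (fun t : ℝ => x + t • d') '' Ioo 0 t₁ ⊆ A.curveᶜ := by
    rintro _ ⟨t, ⟨h0, h1⟩, rfl⟩ hcur
    rcases lt_or_ge t δ with h | h
    · exact inside_subset (hpos t h0 h) hcur
    · exact absurd (csInf_le hTb (show t ∈ T from ⟨h, hcur⟩)) (not_le.2 h1)
  have hchord : A.IsChord x d' (x + t₁ • d') := by
    refine ⟨ht2, by simp [ht0.ne', hd0], ⟨t₁, rfl⟩, ?_⟩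
    rw [hseg]
    rintro _ ⟨τ, ⟨h0, h1⟩, rfl⟩
    exact mem_inside_of_isPreconnected (hconv _ ordConnected_Ioo) hsub
      ⟨δ / 2, ⟨half_pos hδ, by linarith⟩, rfl⟩
      ⟨τ * t₁, ⟨by positivity, by nlinarith⟩, rfl⟩ hhalf
  have hchpos : ∀ t : ℝ, A.IsChord x d' (x + t • d') → 0 < t := by
    rintro t ⟨-, hne, -, hs⟩
    by_contra hle
    have hlt : t < 0 := lt_of_le_of_ne (not_lt.1 hle) (by rintro rfl; simp at hne)
    have hm : 0 < min (1 / 2) (δ / (2 * -t)) := lt_min (by norm_num) (div_pos hδ (by linarith))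
    set τ := min (1 / 2) (δ / (2 * -t))
    have hτ1 : τ ≤ 1 / 2 := min_le_left _ _
    have hτ2 : τ * (2 * -t) ≤ δ := (le_div_iff₀ (by linarith)).1 (min_le_right _ _)
    refine hneg (τ * t) (by nlinarith) (by nlinarith) (hs ?_)
    rw [hseg]
    exact ⟨τ, ⟨hm, by linarith⟩, rfl⟩
  have hlt : ∀ s t : ℝ, A.IsChord x d' (x + s • d') → A.IsChord x d' (x + t • d') → ¬ s < t := by
    intro s t hs ht hst
    have hs0 := hchpos s hs
    refine inside_subset (ht.2.2.2 ?_) hs.1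
    rw [hseg]
    have htp : 0 < t := hs0.trans hst
    exact ⟨s / t, ⟨by positivity, (div_lt_one htp).2 hst⟩, by
      simp only [div_mul_cancel₀ _ htp.ne']⟩
  refine ⟨_, hchord, fun z hz => ?_⟩
  obtain ⟨t, rfl⟩ := hz.2.2.1
  rw [le_antisymm (not_lt.1 (hlt _ _ hchord hz)) (not_lt.1 (hlt _ _ hz hchord))]

/-- The point in which the line through `x` of direction `d` meets the line of the `k`-th edge. It
is meaningful only if these lines are not parallel. -/
def chordEnd (A : Polygon) (k : ZMod A.n) (d x : Plane) : Plane :=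
  x - (A.level k x / det (A.edgeVector k) d) • d

lemma continuous_chordEnd : Continuous (A.chordEnd k d) := by
  have := continuous_level (A := A) (i := k)
  unfold chordEnd; fun_prop

lemma level_chordEnd (hd : det (A.edgeVector k) d ≠ 0) : A.level k (A.chordEnd k d x) = 0 := by
  rw [chordEnd, sub_eq_add_neg, ← neg_smul, level_add_smul]
  field_simp; ring

lemma eq_chordEnd (hd : det (A.edgeVector k) d ≠ 0) {t : ℝ} (h : A.level k (x + t • d) = 0) :
    x + t • d = A.chordEnd k d x := by
  rw [level_add_smul] at h
  have : t = -(A.level k x / det (A.edgeVector k) d) := by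
    rw [← neg_div, eq_div_iff hd]; linarith
  rw [chordEnd, sub_eq_add_neg, ← neg_smul, this]

/-- Chords that do not end in a vertex are stable under moving their start on its edge. -/
theorem eventually_isChord (h : A.IsChord x d z) (hx : x ∈ A.openEdge i) (hz : z ∈ A.openEdge k) :
    A.chordEnd k d x = z ∧ ∀ᶠ x' in 𝓝 x, x' ∈ A.openEdge i →
      A.chordEnd k d x' ∈ A.openEdge k ∧ A.IsChord x' d (A.chordEnd k d x') := by
  have hdi := h.det_ne_zero hx
  have hdk := (h.symm (openEdge_subset_curve hx)).det_ne_zero hz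
  obtain ⟨-, hne, ⟨t, ht⟩, hs⟩ := h
  have hend : A.chordEnd k d x = z := by
    rw [ht, eq_chordEnd hdk]; rw [← ht]; exact (mem_openEdge_iff.1 hz).1
  refine ⟨hend, ?_⟩
  have hcE : Continuous (A.chordEnd k d) := continuous_chordEnd
  have hlx : A.level k x ≠ 0 := by
    intro h0; apply hne; rw [← hend, chordEnd, h0]; simp
  set g : Plane × ℝ → Plane := fun p => p.1 + p.2 • (A.chordEnd k d p.1 - p.1) with hg
  have hgc : Continuous g := by fun_prop
  have hdiff : ∀ x', A.chordEnd k d x' - x' = -(A.level k x' / det (A.edgeVector k) d) • d := by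
    intro x'; rw [chordEnd, neg_smul]; abel
  have htube : ∀ᶠ x' in 𝓝 x, ∀ τ ∈ Icc (0 : ℝ) 1, x' ∈ A.openEdge i → τ ∈ Ioo (0 : ℝ) 1 →
      g (x', τ) ∉ A.curve := by
    refine isCompact_Icc.eventually_forall_of_forall_eventually fun τ hτ => ?_
    have hga : Tendsto g (𝓝 (x, τ)) (𝓝 (g (x, τ))) := hgc.continuousAt
    have hlev : ∀ᶠ p : Plane × ℝ in 𝓝 (x, τ), A.level k p.1 ≠ 0 := by
      have : Continuous fun p : Plane × ℝ => A.level k p.1 :=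
        continuous_level.comp continuous_fst
      exact this.continuousAt.eventually_ne hlx
    rcases hτ.1.eq_or_lt with h0 | h0
    · subst h0
      have hg0 : g (x, 0) = x := by simp [hg]
      rw [hg0] at hga
      filter_upwards [hga.eventually (eventually_mem_openEdge_of_mem_curve hx), hlev] with p hp hl
        hpi hτ hc
      have h1 := (mem_openEdge_iff.1 (hp hc)).1
      simp only [hg, level_add_smul, (mem_openEdge_iff.1 hpi).1, hdiff, det_smul_right] at h1
      have hτ0 := hτ.1.ne'
      have : p.2 * (-(A.level k p.1 / det (A.edgeVector k) d) * det (A.edgeVector i) d) ≠ 0 :=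
        mul_ne_zero hτ0 (mul_ne_zero (neg_ne_zero.2 (div_ne_zero hl hdk)) hdi)
      exact this (by linarith)
    rcases hτ.2.eq_or_lt with h1 | h1
    · subst h1
      have hg1 : g (x, 1) = z := by simp [hg, hend]
      rw [hg1] at hga
      filter_upwards [hga.eventually (eventually_mem_openEdge_of_mem_curve hz), hlev] with p hp hl
        hpi hτ hc
      have h1 := (mem_openEdge_iff.1 (hp hc)).1
      simp only [hg, level_add_smul, hdiff, det_smul_right] at h1
      rw [neg_mul, div_mul_cancel₀ _ hdk] at h1
      have : (1 - p.2) * A.level k p.1 ≠ 0 := mul_ne_zero (by linarith [hτ.2]) hl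
      exact this (by linarith)
    · have hin : g (x, τ) ∈ A.inside := by
        apply hs
        rw [openSegment_eq_add_smul]
        exact ⟨τ, ⟨h0, h1⟩, by simp [hg, hend]⟩
      filter_upwards [hga.eventually (isOpen_inside.mem_nhds hin)] with p hp _ _
      exact inside_subset hp
  have hmid : ∀ᶠ x' in 𝓝 x, g (x', 1 / 2) ∈ A.inside := by
    have hc : Continuous fun x' => g (x', 1 / 2) := by fun_prop
    refine hc.continuousAt.eventually (isOpen_inside.mem_nhds (hs ?_))
    rw [openSegment_eq_add_smul]
    exact ⟨1 / 2, by norm_num, by simp [hg, hend]⟩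
  have hcz : Tendsto (A.chordEnd k d) (𝓝 x) (𝓝 z) := hend ▸ hcE.continuousAt
  filter_upwards [htube, hmid, hcz.eventually (eventually_mem_openEdge_of_level hz),
    continuous_level.continuousAt.eventually_ne hlx] with x' h1 h2 h3 h4 hx'
  have h5 := h3 (level_chordEnd hdk)
  refine ⟨h5, openEdge_subset_curve h5, ?_, ⟨_, by rw [← hdiff, add_sub_cancel]⟩, ?_⟩
  · intro h6
    apply h4
    rw [← h6, level_chordEnd hdk]
  · intro q hq
    refine mem_inside_of_isPreconnected (convex_openSegment _ _).isPreconnected ?_ ?_ hq h2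
    · rw [openSegment_eq_add_smul]
      rintro _ ⟨τ, hτ, rfl⟩
      exact h1 τ ⟨hτ.1.le, hτ.2.le⟩ hx' hτ
    · rw [openSegment_eq_add_smul]
      exact ⟨1 / 2, by norm_num, rfl⟩

end Polygon

/-! ### The billiard map on transversal pairs -/

open Classical in
/-- The first vertex and the edge vector of the open edge of `A` containing `x`, and a junk value
if there is no such edge. This labels the open edges by a type not depending on the polygon. -/
def edgeCode (A : Polygon) (x : Plane) : Plane × Plane :=
  if h : ∃ i, x ∈ A.openEdge i then (A.vertex h.choose, A.edgeVector h.choose) else 0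

/-- The edges that contain the two entries of a phase point. -/
def code (P : Bool → Polygon) (p : PhasePoint) : (Plane × Plane) × (Plane × Plane) :=
  (edgeCode (P p.1) p.2.1, edgeCode (P !p.1) p.2.2)

/-- The pairs of points on open edges which are not parallel. -/
def transversalPairs (P : Bool → Polygon) : Set PhasePoint :=
  {p | ∃ i j, p.2.1 ∈ (P p.1).openEdge i ∧ p.2.2 ∈ (P !p.1).openEdge j ∧
    det ((P p.1).edgeVector i) ((P !p.1).edgeVector j) ≠ 0}

variable {P : Bool → Polygon}

lemma edgeCode_of_mem {A : Polygon} {i : ZMod A.n} {x : Plane} (hx : x ∈ A.openEdge i) :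
    edgeCode A x = (A.vertex i, A.edgeVector i) := by
  have h : ∃ i, x ∈ A.openEdge i := ⟨i, hx⟩
  rw [edgeCode, dif_pos h, Polygon.openEdge_unique h.choose_spec hx]

lemma index_eq_of_edgeCode_eq {A : Polygon} {i j : ZMod A.n} {x y : Plane} (hx : x ∈ A.openEdge i)
    (hy : y ∈ A.openEdge j) (h : edgeCode A x = edgeCode A y) : i = j := by
  rw [edgeCode_of_mem hx, edgeCode_of_mem hy, Prod.mk.injEq] at h
  exact A.vertex_injective h.1

lemma finite_range_edgeCode (A : Polygon) : (range (edgeCode A)).Finite := by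
  refine ((finite_range fun i => (A.vertex i, A.edgeVector i)).insert 0).subset ?_
  rintro _ ⟨x, rfl⟩
  by_cases h : ∃ i, x ∈ A.openEdge i
  · obtain ⟨i, hi⟩ := h
    exact Or.inr ⟨i, (edgeCode_of_mem hi).symm⟩
  · exact Or.inl (dif_neg h)

@[simp] lemma swap_swap (p : PhasePoint) : swap (swap p) = p := by simp [swap]

lemma code_swap (p : PhasePoint) : code P (swap p) = (code P p).swap := by simp [code, swap]

lemma reflects_iff {A B : Polygon} {j : ZMod B.n} {x y z : Plane} (hy : y ∈ B.openEdge j) :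
    Reflects A B x y z ↔ A.IsChord x (B.edgeVector j) z := by
  unfold Reflects Polygon.IsChord
  have : (∃ j, y ∈ B.openEdge j ∧ ∃ t : ℝ, z = x + t • B.edgeVector j) ↔
      ∃ t : ℝ, z = x + t • B.edgeVector j := by
    constructor
    · rintro ⟨k, hk, h⟩; rwa [Polygon.openEdge_unique hy hk]
    · exact fun h => ⟨j, hy, h⟩
  rw [this]

lemma billiardMap_eq {p : PhasePoint} (hp : p ∈ maxPhaseSpace P) {z : Plane}
    (hz : Reflects (P p.1) (P !p.1) p.2.1 p.2.2 z) : billiardMap P p = (!p.1, p.2.2, z) := by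
  rw [billiardMap, hp.2.2.unique (Classical.epsilon_spec hp.2.2.exists) hz]

lemma transversalPairs_subset : transversalPairs P ⊆ maxPhaseSpace P := by
  rintro p ⟨i, j, hx, hy, hd⟩
  refine ⟨⟨Polygon.openEdge_subset_curve hx, Polygon.openEdge_subset_curve hy⟩,
    Polygon.notMem_vertices_of_mem_openEdge hy, ?_⟩
  simp only [reflects_iff hy]
  exact Polygon.existsUnique_isChord hx hd

lemma mem_transversalPairs {p : PhasePoint} (hp : p ∈ maxPhaseSpace P)
    (hx : p.2.1 ∉ (P p.1).vertices) : p ∈ transversalPairs P := by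
  obtain ⟨⟨hx', hy'⟩, hy, ⟨z, hz, -⟩⟩ := hp
  obtain ⟨i, hi⟩ := Polygon.exists_mem_openEdge hx' hx
  obtain ⟨j, hj⟩ := Polygon.exists_mem_openEdge hy' hy
  exact ⟨i, j, hi, hj, ((reflects_iff hj).1 hz).det_ne_zero hi⟩

lemma exists_isChord_of_transversal {p : PhasePoint} (hp : p ∈ transversalPairs P)
    {j : ZMod (P !p.1).n} (hj : p.2.2 ∈ (P !p.1).openEdge j) :
    ∃ z, (P p.1).IsChord p.2.1 ((P !p.1).edgeVector j) z ∧
      billiardMap P p = (!p.1, p.2.2, z) := by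
  have hm := transversalPairs_subset hp
  obtain ⟨z, hz, -⟩ := hm.2.2
  exact ⟨z, (reflects_iff hj).1 hz, billiardMap_eq hm hz⟩

lemma swap_mem_transversalPairs {p : PhasePoint} (hp : p ∈ transversalPairs P) :
    swap p ∈ transversalPairs P := by
  obtain ⟨b, x, y⟩ := p
  obtain ⟨i, j, hx, hy, hd⟩ := hp
  have hd' : det ((P !b).edgeVector j) ((P b).edgeVector i) ≠ 0 := by
    rw [det_comm]; exact neg_ne_zero.2 hd
  cases b <;> exact ⟨j, i, hy, hx, hd'⟩

/-- If the reflected point is not a vertex, then the image of a transversal pair is transversal and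
the motion can be reversed. -/
lemma billiardMap_transversal {p : PhasePoint} (hp : p ∈ transversalPairs P)
    (hz : (billiardMap P p).2.2 ∉ (P p.1).vertices) :
    billiardMap P p ∈ transversalPairs P ∧
      billiardMap P (swap (billiardMap P p)) = swap p := by
  obtain ⟨b, x, y⟩ := p
  obtain ⟨i, j, hx, hy, hd⟩ := id hp
  obtain ⟨z, hc, he⟩ := exists_isChord_of_transversal hp hy
  rw [he] at hz ⊢
  dsimp only at hx hy hd hc hz ⊢
  obtain ⟨k, hk⟩ := Polygon.exists_mem_openEdge hc.1 hz
  have hc' := hc.symm (Polygon.openEdge_subset_curve hx)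
  have hdk := hc'.det_ne_zero hk
  have h1 : ((!b, y, z) : PhasePoint) ∈ transversalPairs P := by
    have hdk' : det ((P !b).edgeVector j) ((P b).edgeVector k) ≠ 0 := by
      rw [det_comm]; exact neg_ne_zero.2 hdk
    cases b <;> exact ⟨j, k, hy, hk, hdk'⟩
  refine ⟨h1, ?_⟩
  have h2 := transversalPairs_subset (swap_mem_transversalPairs h1)
  have h3 : Reflects (P b) (P !b) z y x := (reflects_iff hy).2 hc'
  have h4 := billiardMap_eq h2 (z := x) (by simpa [swap] using h3)
  simpa [swap] using h4

/-- The reflected point depends only on the first entry and on the edge of the second one. -/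
lemma billiardMap_snd_eq {p q : PhasePoint} (hp : p ∈ transversalPairs P)
    (hq : q ∈ transversalPairs P) (h1 : q.1 = p.1) (h2 : q.2.1 = p.2.1)
    (hc : code P q = code P p) : (billiardMap P q).2.2 = (billiardMap P p).2.2 := by
  obtain ⟨b, x, y⟩ := p
  obtain ⟨b', x', y'⟩ := q
  dsimp only at h1 h2
  subst h1 h2
  obtain ⟨i, j, hx, hy, hd⟩ := id hp
  obtain ⟨i', j', hx', hy', -⟩ := id hq
  obtain rfl := index_eq_of_edgeCode_eq hy' hy (congrArg Prod.snd hc)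
  obtain ⟨z, hz, he⟩ := exists_isChord_of_transversal hp hy
  obtain ⟨z', hz', he'⟩ := exists_isChord_of_transversal hq hy'
  rw [he, he']
  exact (Polygon.existsUnique_isChord hx hd).unique hz' hz

lemma eventually_mem_openEdge {b : Bool} {x y : Plane} {i : ZMod (P b).n} {j : ZMod (P !b).n}
    (hx : x ∈ (P b).openEdge i) (hy : y ∈ (P !b).openEdge j) :
    ∀ᶠ q in 𝓝[transversalPairs P] ((b, x, y) : PhasePoint),
      q.1 = b ∧ q.2.1 ∈ (P b).openEdge i ∧ q.2.2 ∈ (P !b).openEdge j := by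
  have h1 : ∀ᶠ q in 𝓝 ((b, x, y) : PhasePoint), q.1 = b :=
    continuous_fst.continuousAt.eventually ((isOpen_discrete {b}).mem_nhds (mem_singleton b))
  have c2 : ContinuousAt (fun q : PhasePoint => q.2.1) (b, x, y) := by fun_prop
  have c3 : ContinuousAt (fun q : PhasePoint => q.2.2) (b, x, y) := by fun_prop
  filter_upwards [nhdsWithin_le_nhds h1, self_mem_nhdsWithin,
    nhdsWithin_le_nhds (c2.eventually (Polygon.eventually_mem_openEdge_of_mem_curve hx)),
    nhdsWithin_le_nhds (c3.eventually (Polygon.eventually_mem_openEdge_of_mem_curve hy))]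
    with q hq1 hqU hq2 hq3
  obtain ⟨b', x', y'⟩ := q
  dsimp only at hq1
  subst hq1
  obtain ⟨hm1, hm2⟩ := (transversalPairs_subset hqU).1
  exact ⟨rfl, hq2 hm1, hq3 hm2⟩

lemma eventually_code_eq {p : PhasePoint} (hp : p ∈ transversalPairs P) :
    ∀ᶠ q in 𝓝[transversalPairs P] p, code P q = code P p := by
  obtain ⟨b, x, y⟩ := p
  obtain ⟨i, j, hx, hy, -⟩ := id hp
  filter_upwards [eventually_mem_openEdge hx hy] with q ⟨h1, h2, h3⟩
  obtain ⟨b', x', y'⟩ := q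
  dsimp only at h1 h2 h3
  subst h1
  dsimp only at hx hy
  simp only [code, edgeCode_of_mem hx, edgeCode_of_mem hy, edgeCode_of_mem h2, edgeCode_of_mem h3]

lemma continuousWithinAt_billiardMap {p : PhasePoint} (hp : p ∈ transversalPairs P)
    (hz : (billiardMap P p).2.2 ∉ (P p.1).vertices) :
    ContinuousWithinAt (billiardMap P) (transversalPairs P) p := by
  obtain ⟨b, x, y⟩ := p
  obtain ⟨i, j, hx, hy, hd⟩ := id hp
  obtain ⟨z, hc, he⟩ := exists_isChord_of_transversal hp hy
  rw [he] at hz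
  dsimp only at hx hy hd hc hz
  obtain ⟨k, hk⟩ := Polygon.exists_mem_openEdge hc.1 hz
  obtain ⟨hend, hev⟩ := Polygon.eventually_isChord hc hx hk
  have c2 : ContinuousAt (fun q : PhasePoint => q.2.1) (b, x, y) := by fun_prop
  have hE := Polygon.continuous_chordEnd (A := P b) (k := k) (d := (P !b).edgeVector j)
  have hlim : Tendsto (fun q : PhasePoint =>
      ((!b, q.2.2, (P b).chordEnd k ((P !b).edgeVector j) q.2.1) : PhasePoint))
      (𝓝[transversalPairs P] (b, x, y)) (𝓝 (!b, y, z)) := by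
    have : Continuous (fun q : PhasePoint =>
      ((!b, q.2.2, (P b).chordEnd k ((P !b).edgeVector j) q.2.1) : PhasePoint)) := by fun_prop
    have h := this.tendsto (b, x, y)
    simp only [hend] at h
    exact h.mono_left nhdsWithin_le_nhds
  rw [ContinuousWithinAt, he]
  refine hlim.congr' ?_
  filter_upwards [eventually_mem_openEdge hx hy, nhdsWithin_le_nhds (c2.eventually hev),
    self_mem_nhdsWithin] with q ⟨h1, h2, h3⟩ h4 hqU
  obtain ⟨b', x', y'⟩ := q
  dsimp only at h1 h2 h3 h4
  subst h1
  exact (billiardMap_eq (transversalPairs_subset hqU) ((reflects_iff h3).2 (h4 h2).2)).symm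

/-! ### The flow on the phase space -/

lemma iterate_mem_discontinuityLevel_zero {m : ℕ} {q : PhasePoint}
    (h : q ∈ discontinuityLevel P m) : (billiardMap P)^[m] q ∈ discontinuityLevel P 0 := by
  induction m generalizing q with
  | zero => exact h
  | succ m ih => exact ih h.2

lemma mem_discontinuityLevel {m : ℕ} {q : PhasePoint}
    (hl : ∀ l < m, (billiardMap P)^[l] q ∈ maxPhaseSpace P)
    (h : (billiardMap P)^[m] q ∈ discontinuityLevel P 0) : q ∈ discontinuityLevel P m := by
  induction m generalizing q with
  | zero => exact h
  | succ m ih =>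
    refine ⟨hl 0 m.succ_pos, ih (fun l hlm => ?_) h⟩
    exact hl (l + 1) (Nat.succ_lt_succ hlm)

lemma notMem_discontinuityLevel_zero {q : PhasePoint} (hq : q ∈ transversalPairs P) :
    q ∉ discontinuityLevel P 0 := fun h => (transversalPairs_subset hq).2.1 h.2

lemma mem_phaseSpace_iff {p : PhasePoint} : p ∈ phaseSpace P ↔
    p ∈ maxPhaseSpace P ∧ ∀ i, p ∉ discontinuityLevel P i ∧ swap p ∉ discontinuityLevel P i := by
  rw [phaseSpace, Set.mem_sdiff, discontinuitySet, mem_union, mem_iUnion, mem_image, not_or]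
  refine and_congr_right fun _ => ?_
  rw [forall_and, not_exists]
  refine and_congr_right fun _ => ⟨fun h i hi => h ⟨swap p, mem_iUnion.2 ⟨i, hi⟩, swap_swap p⟩, ?_⟩
  rintro h ⟨q, hq, rfl⟩
  obtain ⟨i, hi⟩ := mem_iUnion.1 hq
  exact h i (by rwa [swap_swap])

lemma phaseSpace_subset_transversalPairs : phaseSpace P ⊆ transversalPairs P := by
  intro p hp
  obtain ⟨h1, h2⟩ := mem_phaseSpace_iff.1 hp
  refine mem_transversalPairs h1 fun h => (h2 0).2 ⟨h1.1.2, ?_⟩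
  simpa [swap] using h

lemma swap_mem_phaseSpace {p : PhasePoint} (hp : p ∈ phaseSpace P) : swap p ∈ phaseSpace P := by
  rw [mem_phaseSpace_iff]
  refine ⟨transversalPairs_subset
    (swap_mem_transversalPairs (phaseSpace_subset_transversalPairs hp)), fun i => ?_⟩
  rw [swap_swap]
  exact ((mem_phaseSpace_iff.1 hp).2 i).symm

lemma billiardMap_snd_notMem_vertices {p : PhasePoint} (hp : p ∈ phaseSpace P) :
    (billiardMap P p).2.2 ∉ (P p.1).vertices := by
  obtain ⟨h1, h2⟩ := mem_phaseSpace_iff.1 hp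
  intro h
  exact (h2 1).1 ⟨h1, h1.1.2, by simpa [billiardMap] using h⟩

lemma billiardMap_swap_billiardMap {p : PhasePoint} (hp : p ∈ phaseSpace P) :
    billiardMap P (swap (billiardMap P p)) = swap p :=
  (billiardMap_transversal (phaseSpace_subset_transversalPairs hp)
    (billiardMap_snd_notMem_vertices hp)).2

lemma billiardMap_mem_phaseSpace {p : PhasePoint} (hp : p ∈ phaseSpace P) :
    billiardMap P p ∈ phaseSpace P := by
  have ht := (billiardMap_transversal (phaseSpace_subset_transversalPairs hp)
    (billiardMap_snd_notMem_vertices hp)).1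
  obtain ⟨h1, h2⟩ := mem_phaseSpace_iff.1 hp
  refine mem_phaseSpace_iff.2 ⟨transversalPairs_subset ht, fun i =>
    ⟨fun h => (h2 (i + 1)).1 ⟨h1, h⟩, fun h => ?_⟩⟩
  cases i with
  | zero => exact notMem_discontinuityLevel_zero (swap_mem_transversalPairs ht) h
  | succ i =>
    have := h.2
    rw [billiardMap_swap_billiardMap hp] at this
    exact (h2 i).2 this

/-- The billiard map as a permutation of the phase space; its inverse is its conjugate under the
swap map. -/
def flow (P : Bool → Polygon) : Equiv.Perm (phaseSpace P) where
  toFun p := ⟨billiardMap P p, billiardMap_mem_phaseSpace p.2⟩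
  invFun p := ⟨swap (billiardMap P (swap p)),
    swap_mem_phaseSpace (billiardMap_mem_phaseSpace (swap_mem_phaseSpace p.2))⟩
  left_inv p := Subtype.ext (by
    dsimp only; rw [billiardMap_swap_billiardMap p.2, swap_swap])
  right_inv p := Subtype.ext (by
    dsimp only; rw [billiardMap_swap_billiardMap (swap_mem_phaseSpace p.2), swap_swap])

/-- The swap map on the phase space. -/
def flip (p : phaseSpace P) : phaseSpace P := ⟨swap p, swap_mem_phaseSpace p.2⟩

@[simp] lemma flip_flip (p : phaseSpace P) : flip (flip p) = p := Subtype.ext (swap_swap _)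

lemma flip_flow_flip (p : phaseSpace P) : flip (flow P (flip p)) = (flow P)⁻¹ p := rfl

lemma flip_pow (k : ℕ) (p : phaseSpace P) : flip ((flow P ^ k) (flip p)) = ((flow P)⁻¹ ^ k) p := by
  induction k generalizing p with
  | zero => simp
  | succ k ih =>
    rw [pow_succ', pow_succ', Equiv.Perm.mul_apply, Equiv.Perm.mul_apply, ← ih, ← flip_flow_flip,
      flip_flip]

lemma flip_zpow (k : ℤ) (p : phaseSpace P) : flip ((flow P ^ k) p) = (flow P ^ (-k)) (flip p) := by
  obtain ⟨n, rfl | rfl⟩ := k.eq_nat_or_neg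
  · rw [zpow_neg, zpow_natCast, ← inv_pow, ← flip_pow, flip_flip]
  · rw [neg_neg, zpow_neg, zpow_natCast, ← inv_pow, ← flip_pow, flip_flip]

lemma flow_pow_coe (k : ℕ) (p : phaseSpace P) :
    (((flow P ^ k) p : phaseSpace P) : PhasePoint) = (billiardMap P)^[k] p := by
  induction k with
  | zero => rfl
  | succ k ih => rw [pow_succ', Equiv.Perm.mul_apply, Function.iterate_succ_apply', ← ih]; rfl

/-- Two phase points are in the same tile if their bi-infinite orbits visit the same edges. -/
def SameTile (p q : phaseSpace P) : Prop :=
  ∀ k : ℤ, code P ((flow P ^ k) p) = code P ((flow P ^ k) q)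

lemma SameTile.refl (p : phaseSpace P) : SameTile p p := fun _ => rfl

lemma SameTile.symm {p q : phaseSpace P} (h : SameTile p q) : SameTile q p := fun k => (h k).symm

lemma SameTile.trans {p q r : phaseSpace P} (h : SameTile p q) (h' : SameTile q r) :
    SameTile p r := fun k => (h k).trans (h' k)

lemma SameTile.zpow {p q : phaseSpace P} (h : SameTile p q) (n : ℤ) :
    SameTile ((flow P ^ n) p) ((flow P ^ n) q) := fun k => by
  rw [← Equiv.Perm.mul_apply, ← Equiv.Perm.mul_apply, ← zpow_add]; exact h _

lemma SameTile.flip {p q : phaseSpace P} (h : SameTile p q) :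
    SameTile (SymplecticBilliard.flip p) (SymplecticBilliard.flip q) := fun k => by
  have := congrArg Prod.swap (h (-k))
  rw [← code_swap, ← code_swap] at this
  have e : ∀ r : phaseSpace P, (flow P ^ k) (SymplecticBilliard.flip r) =
      SymplecticBilliard.flip ((flow P ^ (-k)) r) := fun r => by rw [flip_zpow, neg_neg]
  rw [e, e]; exact this

/-! ### Tiles are bounded by critical points -/

/-- The second entry of `p` is moved along its edge. As long as it meets no critical point, all
iterates keep to the same edges: an iterate could only leave its edge through a vertex, which makes
the moved entry critical. -/
lemma iterate_along {p : PhasePoint} (hp : p ∈ phaseSpace P) {j : ZMod (P !p.1).n} {w : Plane}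
    (hedge : ∀ t ∈ Icc (0 : ℝ) 1, p.2.2 + t • w ∈ (P !p.1).openEdge j)
    (hC : ∀ t ∈ Ioc (0 : ℝ) 1, (!p.1, p.2.2 + t • w) ∉ criticalPoints P) (m : ℕ) :
    ContinuousOn (fun t : ℝ => (billiardMap P)^[m] (p.1, p.2.1, p.2.2 + t • w)) (Icc 0 1) ∧
    ∀ t ∈ Icc (0 : ℝ) 1,
      (∀ l ≤ m, (billiardMap P)^[l] (p.1, p.2.1, p.2.2 + t • w) ∈ transversalPairs P) ∧
      ((billiardMap P)^[m] (p.1, p.2.1, p.2.2 + t • w)).1 = ((billiardMap P)^[m] p).1 ∧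
      code P ((billiardMap P)^[m] (p.1, p.2.1, p.2.2 + t • w)) = code P ((billiardMap P)^[m] p) ∧
      (Even m → ((billiardMap P)^[m] (p.1, p.2.1, p.2.2 + t • w)).2.1 =
        ((billiardMap P)^[m] p).2.1) ∧
      (Odd m → ((billiardMap P)^[m] (p.1, p.2.1, p.2.2 + t • w)).2.2 =
        ((billiardMap P)^[m] p).2.2) := by
  set γ : ℝ → PhasePoint := fun t => (p.1, p.2.1, p.2.2 + t • w) with hγ
  have hγ0 : γ 0 = p := by simp [hγ]
  have hS : ∀ m, (billiardMap P)^[m] p ∈ phaseSpace P := fun m => by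
    rw [← flow_pow_coe m ⟨p, hp⟩]; exact Subtype.coe_prop _
  have hU : ∀ m, (billiardMap P)^[m] p ∈ transversalPairs P := fun m =>
    phaseSpace_subset_transversalPairs (hS m)
  -- Along a continuous path of transversal pairs the edges do not change.
  have hconst : ∀ f : ℝ → PhasePoint, ContinuousOn f (Icc 0 1) →
      (∀ t ∈ Icc (0 : ℝ) 1, f t ∈ transversalPairs P) →
      ∀ t ∈ Icc (0 : ℝ) 1, code P (f t) = code P (f 0) := by
    intro f hf hfU t ht
    refine isPreconnected_Icc.induction₂ (fun s t => code P (f s) = code P (f t)) (fun s hs => ?_)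
      (fun _ _ _ _ _ _ h h' => h.trans h') (fun _ _ _ _ h => h.symm) ht ⟨le_rfl, zero_le_one⟩
    have : Tendsto f (𝓝[Icc 0 1] s) (𝓝[transversalPairs P] (f s)) :=
      tendsto_nhdsWithin_iff.2 ⟨hf s hs, by
        filter_upwards [self_mem_nhdsWithin] with t ht using hfU t ht⟩
    filter_upwards [this.eventually (eventually_code_eq (hfU s hs))] with t ht using ht.symm
  obtain ⟨i, j', hi, hj', hd⟩ := hU 0
  have hj : p.2.2 ∈ (P !p.1).openEdge j := by simpa using hedge 0 ⟨le_rfl, zero_le_one⟩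
  obtain rfl : j' = j := Polygon.openEdge_unique hj' hj
  induction m with
  | zero =>
    refine ⟨by simp only [Function.iterate_zero, id]; fun_prop, fun t ht => ?_⟩
    have h1 := hedge t ht
    refine ⟨fun l hl => ?_, rfl, ?_, fun _ => rfl, fun h => absurd h (by decide)⟩
    · rw [Nat.le_zero.1 hl]
      exact ⟨i, j', hi, h1, hd⟩
    · simp only [Function.iterate_zero, id, code, edgeCode_of_mem hj]
      rw [edgeCode_of_mem h1]
  | succ m ih =>
    obtain ⟨ihc, ih⟩ := ih
    have hnv : ∀ t ∈ Icc (0 : ℝ) 1, (billiardMap P ((billiardMap P)^[m] (γ t))).2.2 ∉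
        (P ((billiardMap P)^[m] (γ t)).1).vertices ∧ (Odd (m + 1) →
        ((billiardMap P)^[m + 1] (γ t)).2.2 = ((billiardMap P)^[m + 1] p).2.2) := by
      intro t ht
      obtain ⟨h1, h2, h3, h4, h5⟩ := ih t ht
      rcases Nat.even_or_odd m with hm | hm
      · have h6 := billiardMap_snd_eq (hU m) (h1 m le_rfl) h2 (h4 hm) h3
        refine ⟨?_, fun _ => ?_⟩
        · rw [h6, h2]
          exact billiardMap_snd_notMem_vertices (hS m)
        · rwa [Function.iterate_succ_apply', Function.iterate_succ_apply']
      · refine ⟨fun hv => ?_, fun h => absurd hm (Nat.not_odd_iff_even.2 (by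
          simpa [Nat.odd_add_one] using h))⟩
        have hN : γ t ∈ discontinuityLevel P (m + 1) := by
          refine mem_discontinuityLevel (fun l hl => transversalPairs_subset
            (h1 l (Nat.lt_succ_iff.1 hl))) ?_
          rw [Function.iterate_succ_apply']
          exact ⟨(transversalPairs_subset (h1 m le_rfl)).1.2, by simpa [billiardMap] using hv⟩
        rcases ht.1.eq_or_lt with h0 | h0
        · rw [← h0, hγ0] at hN
          exact ((mem_phaseSpace_iff.1 hp).2 (m + 1)).1 hN
        · obtain ⟨r, hr⟩ := hm
          refine hC t ⟨h0, ht.2⟩ (mem_iUnion.2 ⟨r + 1, γ t, ?_, rfl⟩)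
          have : 2 * (r + 1) = m + 1 := by omega
          rwa [this]
    have hU' : ∀ t ∈ Icc (0 : ℝ) 1, (billiardMap P)^[m + 1] (γ t) ∈ transversalPairs P := by
      intro t ht
      rw [Function.iterate_succ_apply']
      exact (billiardMap_transversal ((ih t ht).1 m le_rfl) (hnv t ht).1).1
    have hcont : ContinuousOn (fun t => (billiardMap P)^[m + 1] (γ t)) (Icc 0 1) := by
      simp only [Function.iterate_succ_apply']
      intro t ht
      exact (continuousWithinAt_billiardMap ((ih t ht).1 m le_rfl) (hnv t ht).1).comp
        (f := fun t => (billiardMap P)^[m] (γ t)) (ihc t ht) fun s hs => (ih s hs).1 m le_rfl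
    refine ⟨hcont, fun t ht => ⟨fun l hl => ?_, ?_, ?_, fun hm => ?_, (hnv t ht).2⟩⟩
    · rcases Nat.lt_succ_iff_lt_or_eq.1 (Nat.lt_succ_iff.2 hl) with h | rfl
      · exact (ih t ht).1 l (Nat.lt_succ_iff.1 h)
      · exact hU' t ht
    · rw [Function.iterate_succ_apply', Function.iterate_succ_apply', billiardMap, billiardMap,
        (ih t ht).2.1]
    · have := hconst _ hcont hU' t ht
      rwa [hγ0] at this
    · rw [Function.iterate_succ_apply', Function.iterate_succ_apply']
      exact (ih t ht).2.2.2.2 (by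
        rcases Nat.even_or_odd m with h | h
        · exact absurd hm (by simpa [Nat.even_add_one] using h)
        · exact h)

/-- Moving the second entry along its edge without meeting critical points does not change the
tile. -/
theorem exists_sameTile_snd (p : phaseSpace P) {j : ZMod (P !p.1.1).n} {w : Plane}
    (hedge : ∀ t ∈ Icc (0 : ℝ) 1, p.1.2.2 + t • w ∈ (P !p.1.1).openEdge j)
    (hC : ∀ t ∈ Ioc (0 : ℝ) 1, (!p.1.1, p.1.2.2 + t • w) ∉ criticalPoints P) :
    ∃ q : phaseSpace P, q.1 = (p.1.1, p.1.2.1, p.1.2.2 + w) ∧ SameTile p q := by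
  obtain ⟨⟨b, x, y⟩, hp⟩ := p
  dsimp only at hedge hC ⊢
  have one_mem : (1 : ℝ) ∈ Icc (0 : ℝ) 1 := ⟨zero_le_one, le_rfl⟩
  have hf := fun m => (iterate_along hp hedge hC m).2 1 one_mem
  simp only [one_smul] at hf
  -- The backward orbit of the moved point is the forward orbit of the swapped image.
  have hp' := swap_mem_phaseSpace (billiardMap_mem_phaseSpace hp)
  set z := (billiardMap P (b, x, y)).2.2 with hz
  have e' : swap (billiardMap P (b, x, y)) = (b, z, y) := by simp [swap, billiardMap, hz]
  have hback : billiardMap P (b, z, y) = (!b, y, x) := by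
    rw [← e', billiardMap_swap_billiardMap hp]; rfl
  rw [e'] at hp'
  have hf' := fun m => (iterate_along hp' hedge hC m).2 1 one_mem
  simp only [one_smul] at hf'
  set q : PhasePoint := (b, x, y + w) with hq
  have hqs : billiardMap P (b, z, y + w) = swap q := by
    have h := billiardMap_snd_eq (phaseSpace_subset_transversalPairs hp') ((hf' 0).1 0 le_rfl)
      rfl rfl (hf' 0).2.2.1
    rw [hback] at h
    refine Prod.ext rfl (Prod.ext rfl h)
  have hqS : q ∈ phaseSpace P := by
    refine mem_phaseSpace_iff.2 ⟨transversalPairs_subset ((hf 0).1 0 le_rfl), fun i => ⟨fun h => ?_,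
      fun h => ?_⟩⟩
    · exact notMem_discontinuityLevel_zero ((hf i).1 i le_rfl)
        (iterate_mem_discontinuityLevel_zero h)
    · have h1 := iterate_mem_discontinuityLevel_zero h
      rw [← hqs, ← Function.iterate_succ_apply] at h1
      exact notMem_discontinuityLevel_zero ((hf' (i + 1)).1 _ le_rfl) h1
  refine ⟨⟨q, hqS⟩, rfl, fun k => ?_⟩
  obtain ⟨n, rfl | rfl⟩ := k.eq_nat_or_neg
  · rw [zpow_natCast, flow_pow_coe, flow_pow_coe]
    exact ((hf n).2.2.1).symm
  · have key : ∀ r : phaseSpace P, code P ((flow P ^ (-(n : ℤ))) r) =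
        (code P ((billiardMap P)^[n] (swap r))).swap := by
      intro r
      rw [zpow_neg, zpow_natCast, ← inv_pow, ← flip_pow, ← code_swap]
      exact congrArg (fun r => code P (swap r)) (flow_pow_coe n _)
    rw [key, key]
    have h1 := (hf' (n + 1)).2.2.1
    rw [Function.iterate_succ_apply, Function.iterate_succ_apply, hqs, hback] at h1
    rw [h1]; rfl

/-- Moving the first entry along its edge without meeting critical points does not change the
tile. -/
theorem exists_sameTile_fst (p : phaseSpace P) {i : ZMod (P p.1.1).n} {w : Plane}
    (hedge : ∀ t ∈ Icc (0 : ℝ) 1, p.1.2.1 + t • w ∈ (P p.1.1).openEdge i)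
    (hC : ∀ t ∈ Ioc (0 : ℝ) 1, (p.1.1, p.1.2.1 + t • w) ∉ criticalPoints P) :
    ∃ q : phaseSpace P, q.1 = (p.1.1, p.1.2.1 + w, p.1.2.2) ∧ SameTile p q := by
  obtain ⟨⟨b, x, y⟩, hp⟩ := p
  dsimp only at hedge hC ⊢
  have h : ∃ q : phaseSpace P, q.1 = (!b, y, x + w) ∧ SameTile (flip ⟨(b, x, y), hp⟩) q := by
    cases b <;> exact exists_sameTile_snd (flip ⟨(_, x, y), hp⟩) hedge hC
  obtain ⟨q, hq, hs⟩ := h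
  refine ⟨flip q, ?_, by simpa using hs.flip⟩
  show swap q.1 = _
  rw [hq]; simp [swap]

/-! ### Coordinates on tiles -/

/-- The coordinate of `q` along the edge with first vertex `c.1` and edge vector `c.2`. -/
def coord (c : Plane × Plane) (q : Plane) : ℝ :=
  ((q - c.1).1 * c.2.1 + (q - c.1).2 * c.2.2) / (c.2.1 * c.2.1 + c.2.2 * c.2.2)

/-- The coordinate of the first entry of a phase point along its edge. -/
def fstCoord (p : phaseSpace P) : ℝ := coord (code P p).1 p.1.2.1

/-- The coordinate of the second entry of a phase point along its edge. -/
def sndCoord (p : phaseSpace P) : ℝ := coord (code P p).2 p.1.2.2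

lemma fstCoord_flow (p : phaseSpace P) : fstCoord (flow P p) = sndCoord p := rfl

lemma code_flow_fst (p : phaseSpace P) : (code P (flow P p)).1 = (code P p).2 := rfl

lemma eq_add_coord_smul {A : Polygon} {i : ZMod A.n} {x : Plane} (hx : x ∈ A.openEdge i) :
    x = (edgeCode A x).1 + coord (edgeCode A x) x • (edgeCode A x).2 ∧
      0 < coord (edgeCode A x) x ∧ coord (edgeCode A x) x < 1 := by
  obtain ⟨h, h0, h1⟩ := Polygon.mem_openEdge_iff.1 hx
  rw [edgeCode_of_mem hx]
  exact ⟨Polygon.eq_of_level_eq_zero h, h0, h1⟩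

lemma fst_eq (p : phaseSpace P) : p.1.2.1 = (code P p).1.1 + fstCoord p • (code P p).1.2 := by
  obtain ⟨i, j, hx, -, -⟩ := phaseSpace_subset_transversalPairs p.2
  exact (eq_add_coord_smul hx).1

lemma fstCoord_mem (p : phaseSpace P) : 0 < fstCoord p ∧ fstCoord p < 1 := by
  obtain ⟨i, j, hx, -, -⟩ := phaseSpace_subset_transversalPairs p.2
  exact (eq_add_coord_smul hx).2

lemma snd_eq (p : phaseSpace P) : p.1.2.2 = (code P p).2.1 + sndCoord p • (code P p).2.2 :=
  fst_eq (flow P p)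

lemma sndCoord_mem (p : phaseSpace P) : 0 < sndCoord p ∧ sndCoord p < 1 := fstCoord_mem (flow P p)

lemma det_code_ne_zero (p : phaseSpace P) : det (code P p).1.2 (code P p).2.2 ≠ 0 := by
  obtain ⟨i, j, hx, hy, hd⟩ := phaseSpace_subset_transversalPairs p.2
  simpa only [code, edgeCode_of_mem hx, edgeCode_of_mem hy] using hd

lemma code_fst_ne_zero (p : phaseSpace P) : (code P p).1.2 ≠ 0 := by
  intro h
  have := det_code_ne_zero p
  rw [h] at this
  simp [det] at this

lemma code_snd_ne_zero (p : phaseSpace P) : (code P p).2.2 ≠ 0 := code_fst_ne_zero (flow P p)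

/-- The reflected point lies on the line through the first entry which is parallel to the edge of
the second entry. -/
lemma det_reflection (p : phaseSpace P) :
    det (code P p).2.2 ((flow P p).1.2.2 - p.1.2.1) = 0 := by
  have hp := phaseSpace_subset_transversalPairs p.2
  obtain ⟨i, j, hx, hy, hd⟩ := id hp
  obtain ⟨z, hz, he⟩ := exists_isChord_of_transversal hp hy
  obtain ⟨t, ht⟩ := hz.2.2.1
  have h1 : (flow P p).1.2.2 = z := congrArg (fun r : PhasePoint => r.2.2) he
  have h2 : (code P p).2.2 = (P !p.1.1).edgeVector j := by
    simp only [code, edgeCode_of_mem hy]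
  rw [h1, h2, ht, add_sub_cancel_left, det_smul_right, det_self, mul_zero]

lemma fstCoord_flow_flow (p : phaseSpace P) :
    fstCoord (flow P (flow P p)) * det (code P p).2.2 (code P (flow P p)).2.2 =
      fstCoord p * det (code P p).2.2 (code P p).1.2 -
        det (code P p).2.2 ((code P (flow P p)).2.1 - (code P p).1.1) := by
  have h := det_reflection p
  rw [snd_eq (flow P p), fst_eq p] at h
  rw [fstCoord_flow]
  simp only [det_add_right, det_sub_right, det_smul_right] at h ⊢
  linarith

lemma sameTile_flow {p q : phaseSpace P} (h : SameTile p q) : SameTile (flow P p) (flow P q) :=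
  h.zpow 1

lemma SameTile.code_eq {p q : phaseSpace P} (h : SameTile p q) : code P p = code P q := h 0

/-- On a tile, the first coordinate after an even number of steps is an affine function of the
initial one. -/
lemma exists_affine (k : ℕ) (p : phaseSpace P) : ∃ a c : ℝ, ∀ q, SameTile p q →
    fstCoord ((flow P ^ (2 * k)) q) = a * fstCoord q + c := by
  induction k generalizing p with
  | zero => exact ⟨1, 0, fun q _ => by simp⟩
  | succ k ih =>
    obtain ⟨a, c, h⟩ := ih (flow P (flow P p))
    set d := det (code P p).2.2 (code P (flow P p)).2.2 with hd
    have hd0 : d ≠ 0 := det_code_ne_zero (flow P p)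
    refine ⟨a * (det (code P p).2.2 (code P p).1.2 / d),
      c - a * (det (code P p).2.2 ((code P (flow P p)).2.1 - (code P p).1.1) / d), fun q hq => ?_⟩
    have h1 := h _ (sameTile_flow (sameTile_flow hq))
    have h2 := fstCoord_flow_flow q
    rw [← hq.code_eq, ← (sameTile_flow hq).code_eq, ← hd, ← eq_div_iff hd0] at h2
    have e : (flow P ^ (2 * (k + 1))) q = (flow P ^ (2 * k)) (flow P (flow P q)) := by
      rw [mul_add, pow_add]; rfl
    rw [e, h1, h2]; ring

/-! ### Periodic tiles consist of periodic points -/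

/-- Two distinct bounded bi-infinite orbits of an affine map of the line force it to be the identity
or a reflection. -/
lemma eq_of_bounded_affine_recursion {a c : ℝ} {s s' : ℤ → ℝ} (hs : ∀ m, 0 < s m ∧ s m < 1)
    (hs' : ∀ m, 0 < s' m ∧ s' m < 1) (h : ∀ m, s (m + 1) = a * s m + c)
    (h' : ∀ m, s' (m + 1) = a * s' m + c) (hne : s 0 ≠ s' 0) : s 2 = s 0 := by
  have hb : ∀ m, |s m - s' m| < 1 := fun m => abs_sub_lt_iff.2
    ⟨by linarith [(hs m).2, (hs' m).1], by linarith [(hs m).1, (hs' m).2]⟩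
  have hfwd : ∀ (n : ℕ) m, s (m + n) - s' (m + n) = a ^ n * (s m - s' m) := by
    intro n m
    induction n with
    | zero => simp
    | succ n ih =>
      have : m + ((n + 1 : ℕ) : ℤ) = m + n + 1 := by push_cast; ring
      rw [this, h, h', pow_succ]
      linear_combination a * ih
  have hpos : 0 < |s 0 - s' 0| := abs_pos.2 (sub_ne_zero.2 hne)
  have ha : |a| = 1 := by
    rcases lt_trichotomy |a| 1 with hlt | heq | hgt
    · exfalso
      obtain ⟨n, hn⟩ := exists_pow_lt_of_lt_one hpos hlt
      have h1 := hfwd n (-n)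
      rw [neg_add_cancel] at h1
      rw [h1, abs_mul, abs_pow] at hn
      nlinarith [hb (-n), pow_nonneg (abs_nonneg a) n, abs_nonneg (s (-n) - s' (-n))]
    · exact heq
    · exfalso
      obtain ⟨n, hn⟩ := pow_unbounded_of_one_lt (|s 0 - s' 0|⁻¹) hgt
      have h1 := hfwd n 0
      have h2 := hb (0 + n)
      rw [h1, abs_mul, abs_pow] at h2
      have h3 : |s 0 - s' 0|⁻¹ * |s 0 - s' 0| = 1 := inv_mul_cancel₀ hpos.ne'
      nlinarith
  have h01 := h 0
  have h12 := h 1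
  norm_num at h01 h12
  rcases eq_or_eq_neg_of_abs_eq ha with rfl | rfl
  · -- A translation with a bounded orbit is trivial.
    have hn : ∀ n : ℕ, s n = s 0 + n * c := by
      intro n
      induction n with
      | zero => simp
      | succ n ih =>
        have := h n
        push_cast at this ⊢
        rw [this, ih]; ring
    have hc : c = 0 := by
      by_contra hc
      obtain ⟨n, hn'⟩ := exists_nat_gt (|c|⁻¹)
      have h1 : |s n - s 0| < 1 := abs_sub_lt_iff.2
        ⟨by linarith [(hs n).2, (hs 0).1], by linarith [(hs n).1, (hs 0).2]⟩
      have hcp : 0 < |c| := abs_pos.2 hc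
      have h2 : |c|⁻¹ * |c| = 1 := inv_mul_cancel₀ hcp.ne'
      rw [hn, add_sub_cancel_left, abs_mul, Nat.abs_cast] at h1
      nlinarith
    rw [h12, h01, hc]; ring
  · rw [h12, h01]; ring

lemma sameTile_zpow_mul {p : phaseSpace P} {n : ℤ} (h : SameTile p ((flow P ^ n) p)) (m : ℤ) :
    SameTile p ((flow P ^ (n * m)) p) := by
  have e : ∀ k : ℤ, (flow P ^ (n * (k + 1))) p = (flow P ^ (n * k)) ((flow P ^ n) p) := fun k => by
    rw [mul_add, mul_one, zpow_add, Equiv.Perm.mul_apply]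
  induction m using Int.induction_on with
  | zero => simpa using SameTile.refl p
  | succ k ih => rw [e]; exact ih.trans (h.zpow _)
  | pred k ih =>
    have := e (-k - 1)
    rw [sub_add_cancel] at this
    rw [this] at ih
    exact ih.trans (h.zpow _).symm

lemma fst_flow_of_sameTile {p q : phaseSpace P} {k : ℕ}
    (h : SameTile p ((flow P ^ (2 * k)) p)) (hq : SameTile p q) (hne : p.1.2.1 ≠ q.1.2.1) :
    ((flow P ^ (2 * (2 * k))) p).1.2.1 = p.1.2.1 := by
  obtain ⟨a, c, hac⟩ := exists_affine k p
  have hz : SameTile p ((flow P ^ ((2 * k : ℕ) : ℤ)) p) := by rwa [zpow_natCast]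
  have hrec : ∀ r, SameTile p r → ∀ m : ℤ,
      fstCoord ((flow P ^ (((2 * k : ℕ) : ℤ) * (m + 1))) r) =
        a * fstCoord ((flow P ^ (((2 * k : ℕ) : ℤ) * m)) r) + c := by
    intro r hr m
    have h1 : SameTile p ((flow P ^ (((2 * k : ℕ) : ℤ) * m)) r) :=
      (sameTile_zpow_mul hz m).trans (hr.zpow _)
    have h2 := hac _ h1
    rw [← zpow_natCast, ← Equiv.Perm.mul_apply, ← zpow_add] at h2
    rw [← h2, mul_add, mul_one, add_comm]
  have h2 := eq_of_bounded_affine_recursion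
    (s := fun m => fstCoord ((flow P ^ (((2 * k : ℕ) : ℤ) * m)) p))
    (s' := fun m => fstCoord ((flow P ^ (((2 * k : ℕ) : ℤ) * m)) q))
    (fun m => fstCoord_mem _) (fun m => fstCoord_mem _) (hrec p (SameTile.refl p)) (hrec q hq)
    (by
      intro h0
      apply hne
      simp only [mul_zero, zpow_zero, Equiv.Perm.one_apply] at h0
      rw [fst_eq p, fst_eq q, h0, hq.code_eq])
  have e : (flow P ^ (((2 * k : ℕ) : ℤ) * 2)) p = (flow P ^ (2 * (2 * k))) p := by
    rw [← zpow_natCast]; congr 2; push_cast; ring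
  simp only [e, mul_zero, zpow_zero, Equiv.Perm.one_apply] at h2
  have h3 := sameTile_zpow_mul hz 2
  rw [e] at h3
  rw [fst_eq, h2, ← h3.code_eq, ← fst_eq]

lemma label_flow_pow (k : ℕ) (p : phaseSpace P) :
    ((flow P ^ k) p).1.1 = if Even k then p.1.1 else !p.1.1 := by
  induction k with
  | zero => simp
  | succ k ih =>
    rw [pow_succ', Equiv.Perm.mul_apply]
    have : ((flow P) ((flow P ^ k) p)).1.1 = !((flow P ^ k) p).1.1 := rfl
    rw [this, ih]
    by_cases h : Even k <;> simp [h, Nat.even_add_one]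

/-- If a tile is mapped to itself by an even iterate and extends in both directions, then the square
of this iterate fixes it pointwise. -/
theorem flow_pow_eq_self {p : phaseSpace P} {k : ℕ} (h : SameTile p ((flow P ^ (2 * k)) p))
    (hx : ∃ q, SameTile p q ∧ p.1.2.1 ≠ q.1.2.1) (hy : ∃ q, SameTile p q ∧ p.1.2.2 ≠ q.1.2.2) :
    (flow P ^ (2 * (2 * k))) p = p := by
  obtain ⟨q, hq, hne⟩ := hx
  obtain ⟨q', hq', hne'⟩ := hy
  have e : ∀ n : ℕ, (flow P ^ n) (flow P p) = flow P ((flow P ^ n) p) := fun n => by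
    rw [← Equiv.Perm.mul_apply, ← Equiv.Perm.mul_apply, ← pow_succ, ← pow_succ']
  have h1 := fst_flow_of_sameTile h hq hne
  have h2 := fst_flow_of_sameTile (p := flow P p) (q := flow P q') (k := k)
    (by rw [e]; exact sameTile_flow h) (sameTile_flow hq') hne'
  rw [e] at h2
  refine Subtype.ext (Prod.ext ?_ (Prod.ext h1 h2))
  rw [label_flow_pow, if_pos (even_two_mul _)]

lemma hasOrbitOfPeriod {p : phaseSpace P} {n : ℕ} (hn : 0 < n) (h : (flow P ^ n) p = p) :
    HasOrbitOfPeriod (billiardMap P) (phaseSpace P) p n := by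
  have horb : IsOrbit (billiardMap P) (phaseSpace P) p
      fun k : ℤ => ((flow P ^ k) p : phaseSpace P) := by
    refine ⟨by simp, fun k => ⟨Subtype.coe_prop _, ?_⟩⟩
    have : (flow P ^ (k + 1)) p = flow P ((flow P ^ k) p) := by
      rw [add_comm, zpow_add, zpow_one, Equiv.Perm.mul_apply]
    simp only [this]; rfl
  refine ⟨hn, ⟨_, horb⟩, fun o ho => ?_⟩
  have huniq : ∀ k : ℤ, (⟨o k, (ho.2 k).1⟩ : phaseSpace P) = (flow P ^ k) p := by
    have hstep : ∀ k : ℤ, (⟨o (k + 1), (ho.2 (k + 1)).1⟩ : phaseSpace P) =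
        flow P ⟨o k, (ho.2 k).1⟩ := fun k => Subtype.ext (ho.2 k).2.symm
    have e : ∀ k : ℤ, (flow P ^ (k + 1)) p = flow P ((flow P ^ k) p) := fun k => by
      rw [add_comm, zpow_add, zpow_one, Equiv.Perm.mul_apply]
    intro k
    induction k using Int.induction_on with
    | zero => exact Subtype.ext (by simpa using ho.1)
    | succ k ih => rw [hstep, ih, e]
    | pred k ih =>
      apply (flow P).injective
      rw [← hstep, ← e]
      simpa only [sub_add_cancel] using ih
  intro k
  have h1 : (⟨o (k + n), (ho.2 (k + n)).1⟩ : phaseSpace P) = ⟨o k, (ho.2 k).1⟩ := by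
    rw [huniq, huniq, zpow_add, Equiv.Perm.mul_apply, zpow_natCast, h]
  exact congrArg Subtype.val h1

lemma sameTile_of_sameTile_iterates {p : phaseSpace P} {m n : ℕ} (hmn : m < n)
    (h : SameTile ((flow P ^ m) p) ((flow P ^ n) p)) : SameTile p ((flow P ^ (n - m)) p) := by
  have h1 := h.zpow (-m)
  have e : ∀ k : ℕ, (flow P ^ (-(m : ℤ))) ((flow P ^ k) p) =
      (flow P ^ ((k : ℤ) - m)) p := fun k => by
    rw [← zpow_natCast, ← Equiv.Perm.mul_apply, ← zpow_add]; congr 2; ring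
  rw [e, e, sub_self, zpow_zero, Equiv.Perm.one_apply, ← Nat.cast_sub hmn.le, zpow_natCast] at h1
  exact h1

lemma even_sub_of_label_eq {p : phaseSpace P} {m n : ℕ} (hmn : m < n)
    (h : ((flow P ^ m) p).1.1 = ((flow P ^ n) p).1.1) : Even (n - m) := by
  rw [label_flow_pow, label_flow_pow] at h
  rw [Nat.even_sub hmn.le]
  by_cases h1 : Even m <;> by_cases h2 : Even n <;> simp [h1, h2] at h ⊢

/-- Two iterates in the same tile and with the same label bound the period. -/
theorem hasOrbitOfPeriod_of_sameTile {p : phaseSpace P} {m n : ℕ} (hmn : m < n)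
    (hl : ((flow P ^ m) p).1.1 = ((flow P ^ n) p).1.1)
    (h : SameTile ((flow P ^ m) p) ((flow P ^ n) p))
    (hx : ∃ q, SameTile p q ∧ p.1.2.1 ≠ q.1.2.1) (hy : ∃ q, SameTile p q ∧ p.1.2.2 ≠ q.1.2.2) :
    HasOrbitOfPeriod (billiardMap P) (phaseSpace P) p (2 * (n - m)) := by
  obtain ⟨k, hk⟩ := even_sub_of_label_eq hmn hl
  have h1 := sameTile_of_sameTile_iterates hmn h
  rw [hk, ← two_mul] at h1 ⊢
  exact hasOrbitOfPeriod (by omega) (flow_pow_eq_self h1 hx hy)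

/-! ### Recurrence of tiles that contain a rectangle -/

/-- The tile of `p` contains the rectangle around `p` whose half side lengths, in edge coordinates,
are `α` and `β`. -/
def HasBox (p : phaseSpace P) (α β : ℝ) : Prop :=
  ∀ s t : ℝ, |s| < α → |t| < β → ∃ q : phaseSpace P,
    q.1 = (p.1.1, p.1.2.1 + s • (code P p).1.2, p.1.2.2 + t • (code P p).2.2) ∧ SameTile p q

lemma HasBox.mono {p : phaseSpace P} {α β α' β' : ℝ} (h : HasBox p α β) (hα : α' ≤ α)
    (hβ : β' ≤ β) : HasBox p α' β' := fun s t hs ht =>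
  h s t (hs.trans_le hα) (ht.trans_le hβ)

/-- The image of a rectangle is a rectangle; the symplectic area is preserved. -/
lemma HasBox.flow {p : phaseSpace P} {α β : ℝ} (h : HasBox p α β) :
    HasBox (flow P p) β (α * (|det (code P p).1.2 (code P p).2.2| /
      |det (code P p).2.2 (code P (flow P p)).2.2|)) := by
  intro s t hs ht
  set d := det (code P p).1.2 (code P p).2.2 with hd
  set d' := det (code P p).2.2 (code P (SymplecticBilliard.flow P p)).2.2 with hd'
  have hd0 : d ≠ 0 := det_code_ne_zero p
  have hd0' : d' ≠ 0 := det_code_ne_zero (SymplecticBilliard.flow P p)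
  have hdc : det (code P p).2.2 (code P p).1.2 = -d := det_comm _ _
  obtain ⟨q, hq, hpq⟩ := h (-(t * d') / d) s (by
    rw [abs_div, abs_neg, abs_mul, div_lt_iff₀ (abs_pos.2 hd0)]
    rwa [← mul_div_assoc, lt_div_iff₀ (abs_pos.2 hd0')] at ht) hs
  refine ⟨SymplecticBilliard.flow P q, ?_, sameTile_flow hpq⟩
  have h1 : (SymplecticBilliard.flow P q).1 =
      (!q.1.1, q.1.2.2, (SymplecticBilliard.flow P q).1.2.2) := rfl
  have h2 : (SymplecticBilliard.flow P p).1.2.1 = p.1.2.2 := rfl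
  have h3 : (SymplecticBilliard.flow P p).1.1 = !p.1.1 := rfl
  rw [h1, hq, h2, h3, code_flow_fst]
  refine Prod.ext rfl (Prod.ext rfl ?_)
  dsimp only
  have e1 := det_reflection p
  have e2 := det_reflection q
  rw [← hpq.code_eq, hq] at e2
  have e3 := snd_eq (SymplecticBilliard.flow P p)
  have e4 := snd_eq (SymplecticBilliard.flow P q)
  rw [← (sameTile_flow hpq).code_eq] at e4
  set τ := sndCoord (SymplecticBilliard.flow P q) - sndCoord (SymplecticBilliard.flow P p) with hτ
  have e5 : (SymplecticBilliard.flow P q).1.2.2 = (SymplecticBilliard.flow P p).1.2.2 +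
      τ • (code P (SymplecticBilliard.flow P p)).2.2 := by
    rw [e3, e4, hτ, sub_smul]; abel
  rw [e5] at e2 ⊢
  simp only [det_sub_right, det_add_right, det_smul_right, hdc, ← hd'] at e1 e2
  have e6 : τ = t := by
    have h4 : -(t * d') / d * d = -(t * d') := div_mul_cancel₀ _ hd0
    have h5 : (τ - t) * d' = 0 := by linarith
    exact sub_eq_zero.1 ((mul_eq_zero.1 h5).resolve_right hd0')
  rw [e6]

lemma HasBox.le_one {p : phaseSpace P} {α β : ℝ} (h : HasBox p α β) (hβ : 0 < β) : α ≤ 1 := by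
  by_contra! hα
  obtain ⟨q, hq, hpq⟩ := h 1 0 (by simpa using hα) (by simpa using hβ)
  have h1 := fst_eq q
  rw [← hpq.code_eq, hq, fst_eq p, add_assoc, ← add_smul] at h1
  have h2 := smul_left_injective ℝ (code_fst_ne_zero p) (add_left_cancel h1)
  linarith [(fstCoord_mem p).1, (fstCoord_mem q).2]

lemma HasBox.exists_fst_ne {p : phaseSpace P} {α β : ℝ} (h : HasBox p α β) (hα : 0 < α)
    (hβ : 0 < β) : ∃ q, SameTile p q ∧ p.1.2.1 ≠ q.1.2.1 := by
  obtain ⟨q, hq, hpq⟩ := h (α / 2) 0 (by rw [abs_of_pos (half_pos hα)]; linarith) (by simpa)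
  refine ⟨q, hpq, ?_⟩
  rw [hq]
  simp [hα.ne', code_fst_ne_zero]

lemma HasBox.exists_snd_ne {p : phaseSpace P} {α β : ℝ} (h : HasBox p α β) (hα : 0 < α)
    (hβ : 0 < β) : ∃ q, SameTile p q ∧ p.1.2.2 ≠ q.1.2.2 := by
  obtain ⟨q, hq, hpq⟩ := h 0 (β / 2) (by simpa) (by rw [abs_of_pos (half_pos hβ)]; linarith)
  refine ⟨q, hpq, ?_⟩
  rw [hq]
  simp [hβ.ne', code_snd_ne_zero]

lemma finite_range_code (P : Bool → Polygon) : (range (code P)).Finite := by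
  have h : (⋃ b, range (edgeCode (P b))).Finite :=
    finite_iUnion fun b => finite_range_edgeCode (P b)
  refine (h.prod h).subset ?_
  rintro _ ⟨p, rfl⟩
  exact ⟨mem_iUnion.2 ⟨_, mem_range_self _⟩, mem_iUnion.2 ⟨_, mem_range_self _⟩⟩

/-- The iterates of a rectangle keep their symplectic area, and so their sides do not shrink. -/
lemma HasBox.exists_uniform {p : phaseSpace P} {α β : ℝ} (h : HasBox p α β) (hα : 0 < α)
    (hβ : 0 < β) : ∃ δ > 0, ∀ k : ℕ, HasBox ((SymplecticBilliard.flow P ^ k) p) δ δ := by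
  set W := α * β * |det (code P p).1.2 (code P p).2.2| with hW
  have hW0 : 0 < W := mul_pos (mul_pos hα hβ) (abs_pos.2 (det_code_ne_zero p))
  have key : ∀ k : ℕ, ∃ α' β', 0 < α' ∧ 0 < β' ∧
      HasBox ((SymplecticBilliard.flow P ^ k) p) α' β' ∧
      α' * β' * |det (code P ((SymplecticBilliard.flow P ^ k) p)).1.2
        (code P ((SymplecticBilliard.flow P ^ k) p)).2.2| = W := by
    intro k
    induction k with
    | zero => exact ⟨α, β, hα, hβ, h, rfl⟩
    | succ k ih =>
      obtain ⟨α', β', h1, h2, h3, h4⟩ := ih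
      rw [pow_succ', Equiv.Perm.mul_apply]
      set r := (SymplecticBilliard.flow P ^ k) p
      have p1 := abs_pos.2 (det_code_ne_zero r)
      have p2 := abs_pos.2 (det_code_ne_zero (SymplecticBilliard.flow P r))
      rw [code_flow_fst] at p2
      refine ⟨_, _, h2, by positivity, h3.flow, ?_⟩
      rw [code_flow_fst, ← h4]
      field_simp
  obtain ⟨D, hD⟩ := ((finite_range_code P).image fun c => |det c.1.2 c.2.2|).bddAbove
  have hD' : ∀ r : phaseSpace P, |det (code P r).1.2 (code P r).2.2| ≤ D := fun r =>
    hD ⟨_, ⟨r.1, rfl⟩, rfl⟩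
  have hD0 : 0 < D := (abs_pos.2 (det_code_ne_zero p)).trans_le (hD' p)
  refine ⟨W / D, div_pos hW0 hD0, fun k => ?_⟩
  obtain ⟨α', β', h1, h2, h3, h4⟩ := key k
  have hb1 := h3.le_one h2
  have hb2 : β' ≤ 1 := h3.flow.le_one (by
    have p1 := abs_pos.2 (det_code_ne_zero ((SymplecticBilliard.flow P ^ k) p))
    have p2 := abs_pos.2 (det_code_ne_zero
      (SymplecticBilliard.flow P ((SymplecticBilliard.flow P ^ k) p)))
    rw [code_flow_fst] at p2
    positivity)
  have hd := hD' ((SymplecticBilliard.flow P ^ k) p)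
  set d := |det (code P ((SymplecticBilliard.flow P ^ k) p)).1.2
        (code P ((SymplecticBilliard.flow P ^ k) p)).2.2|
  have hd0 : 0 ≤ d := abs_nonneg _
  refine h3.mono ((div_le_iff₀ hD0).2 ?_) ((div_le_iff₀ hD0).2 ?_)
  · rw [← h4]
    calc α' * β' * d ≤ α' * 1 * D := by gcongr
      _ = α' * D := by ring
  · rw [← h4]
    calc α' * β' * d ≤ 1 * β' * D := by gcongr
      _ = β' * D := by ring

lemma abs_sub_lt_of_floor_eq {δ u v : ℝ} (hδ : 0 < δ) (h : ⌊u / δ⌋ = ⌊v / δ⌋) : |v - u| < δ := by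
  have h1 := Int.abs_sub_lt_one_of_floor_eq_floor h.symm
  rw [← sub_div, abs_div, abs_of_pos hδ, div_lt_one hδ] at h1
  exact h1

/-- A point whose tile contains a rectangle is periodic: infinitely many rectangles with sides
bounded below cannot be disjoint. -/
theorem HasBox.exists_hasOrbitOfPeriod {p : phaseSpace P} {α β : ℝ} (h : HasBox p α β)
    (hα : 0 < α) (hβ : 0 < β) :
    ∃ n, HasOrbitOfPeriod (billiardMap P) (phaseSpace P) p n := by
  obtain ⟨δ, hδ, hbox⟩ := h.exists_uniform hα hβ
  set f : ℕ → Bool × ((Plane × Plane) × (Plane × Plane)) × ℤ × ℤ := fun k =>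
    (((SymplecticBilliard.flow P ^ k) p).1.1, code P ((SymplecticBilliard.flow P ^ k) p),
      ⌊fstCoord ((SymplecticBilliard.flow P ^ k) p) / δ⌋,
      ⌊sndCoord ((SymplecticBilliard.flow P ^ k) p) / δ⌋) with hf
  set T : Set (Bool × ((Plane × Plane) × (Plane × Plane)) × ℤ × ℤ) :=
    univ ×ˢ (range (code P) ×ˢ (Icc 0 ⌊1 / δ⌋ ×ˢ Icc 0 ⌊1 / δ⌋))
  have hfin : T.Finite :=
    finite_univ.prod ((finite_range_code P).prod ((finite_Icc _ _).prod (finite_Icc _ _)))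
  have hfl : ∀ u : ℝ, 0 < u ∧ u < 1 → ⌊u / δ⌋ ∈ Icc 0 ⌊1 / δ⌋ := fun u hu =>
    ⟨Int.floor_nonneg.2 (div_nonneg hu.1.le hδ.le), Int.floor_le_floor (by gcongr; exact hu.2.le)⟩
  have hmaps : MapsTo f univ T := fun k _ =>
    ⟨mem_univ _, mem_range_self _, hfl _ (fstCoord_mem _), hfl _ (sndCoord_mem _)⟩
  obtain ⟨m, -, n, -, hne, hmn⟩ := infinite_univ.exists_ne_map_eq_of_mapsTo hmaps hfin
  wlog hlt : m < n generalizing m n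
  · exact this n m hne.symm hmn.symm (lt_of_le_of_ne (not_lt.1 hlt) hne.symm)
  simp only [hf, Prod.mk.injEq] at hmn
  obtain ⟨h1, h2, h3, h4⟩ := hmn
  set pm := (SymplecticBilliard.flow P ^ m) p with hpm
  set pn := (SymplecticBilliard.flow P ^ n) p with hpn
  obtain ⟨q, hq, hs⟩ := hbox m _ _ (abs_sub_lt_of_floor_eq hδ h3) (abs_sub_lt_of_floor_eq hδ h4)
  have hqn : q = pn := by
    refine Subtype.ext (hq.trans (Prod.ext h1 (Prod.ext ?_ ?_)))
    · dsimp only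
      rw [fst_eq pn, fst_eq pm, sub_smul, h2]; abel
    · dsimp only
      rw [snd_eq pn, snd_eq pm, sub_smul, h2]; abel
  rw [hqn] at hs
  exact ⟨_, hasOrbitOfPeriod_of_sameTile hlt h1 hs (h.exists_fst_ne hα hβ) (h.exists_snd_ne hα hβ)⟩

/-! ### Points that are not limits of critical points -/

/-- Both entries of a phase point are moved along their edges without meeting critical points. -/
lemma exists_sameTile (p : phaseSpace P) {i : ZMod (P p.1.1).n} {j : ZMod (P !p.1.1).n}
    {w w' : Plane} (hi : ∀ t ∈ Icc (0 : ℝ) 1, p.1.2.1 + t • w ∈ (P p.1.1).openEdge i)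
    (hCi : w ≠ 0 → ∀ t ∈ Ioc (0 : ℝ) 1, (p.1.1, p.1.2.1 + t • w) ∉ criticalPoints P)
    (hj : ∀ t ∈ Icc (0 : ℝ) 1, p.1.2.2 + t • w' ∈ (P !p.1.1).openEdge j)
    (hCj : w' ≠ 0 → ∀ t ∈ Ioc (0 : ℝ) 1, (!p.1.1, p.1.2.2 + t • w') ∉ criticalPoints P) :
    ∃ q : phaseSpace P, q.1 = (p.1.1, p.1.2.1 + w, p.1.2.2 + w') ∧ SameTile p q := by
  have h1 : ∃ q : phaseSpace P, q.1 = (p.1.1, p.1.2.1 + w, p.1.2.2) ∧ SameTile p q := by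
    rcases eq_or_ne w 0 with rfl | hw
    · exact ⟨p, by simp, SameTile.refl p⟩
    · exact exists_sameTile_fst p hi (hCi hw)
  obtain ⟨⟨_, hq⟩, rfl, hs⟩ := h1
  rcases eq_or_ne w' 0 with rfl | hw
  · exact ⟨_, by simp, hs⟩
  · obtain ⟨r, hr, hs'⟩ := exists_sameTile_snd ⟨_, hq⟩ hj (hCj hw)
    exact ⟨r, hr, hs.trans hs'⟩

lemma exists_free_radius {b : Bool} {i : ZMod (P b).n} {x : Plane} (hx : x ∈ (P b).openEdge i)
    (hC : ∀ᶠ y in 𝓝[≠] x, (b, y) ∉ criticalPoints P) :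
    ∃ α > 0, ∀ s : ℝ, |s| < α → x + s • (P b).edgeVector i ∈ (P b).openEdge i ∧
      (s ≠ 0 → (b, x + s • (P b).edgeVector i) ∉ criticalPoints P) := by
  have h1 := (Polygon.tendsto_add_smul x ((P b).edgeVector i) (𝓝 0) le_rfl).eventually
    ((eventually_nhdsWithin_iff.1 hC).and (Polygon.eventually_mem_openEdge_of_level hx))
  obtain ⟨α, hα, h2⟩ := Metric.eventually_nhds_iff.1 h1
  refine ⟨α, hα, fun s hs => ?_⟩
  obtain ⟨h3, h4⟩ := h2 (by simpa using hs)
  refine ⟨h4 ?_, fun hs0 => h3 ?_⟩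
  · rw [Polygon.level_add_smul, (Polygon.mem_openEdge_iff.1 hx).1, det_self]; simp
  · simp [hs0, Polygon.edgeVector_ne_zero]

/-- Around a point whose entries are no limits of critical points, the tile contains a rectangle. -/
theorem exists_hasBox (p : phaseSpace P)
    (hx : ∀ᶠ y in 𝓝[≠] p.1.2.1, (p.1.1, y) ∉ criticalPoints P)
    (hy : ∀ᶠ y in 𝓝[≠] p.1.2.2, (!p.1.1, y) ∉ criticalPoints P) :
    ∃ α > 0, ∃ β > 0, HasBox p α β := by
  obtain ⟨i, j, hi, hj, -⟩ := phaseSpace_subset_transversalPairs p.2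
  obtain ⟨α, hα, h1⟩ := exists_free_radius hi hx
  obtain ⟨β, hβ, h2⟩ := exists_free_radius hj hy
  refine ⟨α, hα, β, hβ, ?_⟩
  · intro s t hs ht
    have hlt : ∀ {a γ r : ℝ}, |a| < γ → r ∈ Icc (0 : ℝ) 1 → |r * a| < γ := by
      intro a γ r ha hr
      rw [abs_mul, abs_of_nonneg hr.1]
      nlinarith [abs_nonneg a, hr.2]
    simp only [code, edgeCode_of_mem hi, edgeCode_of_mem hj]
    refine exists_sameTile p (i := i) (j := j) (fun r hr => ?_) (fun hw r hr => ?_) (fun r hr => ?_)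
      (fun hw r hr => ?_)
    · rw [smul_smul]; exact (h1 _ (hlt hs hr)).1
    · rw [smul_smul]
      refine (h1 _ (hlt hs ⟨hr.1.le, hr.2⟩)).2 (mul_ne_zero hr.1.ne' ?_)
      rintro rfl; simp at hw
    · rw [smul_smul]; exact (h2 _ (hlt ht hr)).1
    · rw [smul_smul]
      refine (h2 _ (hlt ht ⟨hr.1.le, hr.2⟩)).2 (mul_ne_zero hr.1.ne' ?_)
      rintro rfl; simp at hw

/-! ### Almost every point is regular -/

lemma fst_eq_chordEnd {p : PhasePoint} (hp : p ∈ maxPhaseSpace P) :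
    p.2.1 ∈ (P p.1).vertices ∨ ∃ i j, p.2.1 =
      (P p.1).chordEnd i ((P !p.1).edgeVector j) (billiardMap P p).2.2 := by
  by_cases hv : p.2.1 ∈ (P p.1).vertices
  · exact Or.inl hv
  right
  have ht := mem_transversalPairs hp hv
  obtain ⟨i, j, hx, hy, hd⟩ := id ht
  obtain ⟨z, hz, he⟩ := exists_isChord_of_transversal ht hy
  refine ⟨i, j, ?_⟩
  rw [he]
  obtain ⟨t, hxt⟩ := (hz.symm hp.1.1).2.2.1
  rw [← Polygon.eq_chordEnd hd (t := t)]
  · exact hxt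
  · rw [← hxt]; exact (Polygon.mem_openEdge_iff.1 hx).1

/-- The points of a level of the discontinuity set have one of their entries in a countable set,
the preimages of the vertices under finitely many affine maps. -/
lemma exists_countable_level (P : Bool → Polygon) (k : ℕ) : ∃ F : Set Plane, F.Countable ∧
    ∀ p ∈ discontinuityLevel P k, (Even k → p.2.2 ∈ F) ∧ (Odd k → p.2.1 ∈ F) := by
  have hV : (⋃ b, (P b).vertices).Countable :=
    countable_iUnion fun b => (P b).finite_vertices.countable
  induction k with
  | zero =>
    exact ⟨_, hV, fun p hp => ⟨fun _ => mem_iUnion.2 ⟨_, hp.2⟩, fun h => absurd h (by decide)⟩⟩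
  | succ k ih =>
    obtain ⟨F, hF, h⟩ := ih
    rcases Nat.even_or_odd k with hk | hk
    · refine ⟨(⋃ b, (P b).vertices) ∪ ⋃ b, ⋃ i, ⋃ j,
        (P b).chordEnd i ((P !b).edgeVector j) '' F, hV.union (countable_iUnion fun b =>
          countable_iUnion fun i => countable_iUnion fun j => hF.image _), fun p hp => ?_⟩
      refine ⟨fun h' => absurd hk (by simpa [Nat.even_add_one] using h'), fun _ => ?_⟩
      have hz := (h _ hp.2).1 hk
      rcases fst_eq_chordEnd hp.1 with hv | ⟨i, j, he⟩
      · exact Or.inl (mem_iUnion.2 ⟨_, hv⟩)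
      · refine Or.inr (mem_iUnion.2 ⟨p.1, mem_iUnion.2 ⟨i, mem_iUnion.2 ⟨j, _, hz, he.symm⟩⟩⟩)
    · refine ⟨F, hF, fun p hp => ⟨fun _ => (h _ hp.2).2 hk, fun h' => absurd hk ?_⟩⟩
      simpa [Nat.odd_add_one] using h'

lemma exists_countable_exceptional (P : Bool → Polygon) : ∃ F : Set Plane, F.Countable ∧
    ∀ p : PhasePoint, p.2.1 ∉ F → p.2.2 ∉ F →
      p ∉ criticalGrid P ∧ (p ∈ maxPhaseSpace P → p ∈ phaseSpace P) := by
  choose F hF h using exists_countable_level P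
  have hlev : ∀ q : PhasePoint, q.2.1 ∉ ⋃ k, F k → q.2.2 ∉ ⋃ k, F k →
      ∀ k, q ∉ discontinuityLevel P k := by
    intro q hx hy k hk
    rcases Nat.even_or_odd k with he | ho
    · exact hy (mem_iUnion.2 ⟨k, (h k q hk).1 he⟩)
    · exact hx (mem_iUnion.2 ⟨k, (h k q hk).2 ho⟩)
  have hcrit : ∀ b x, (b, x) ∈ criticalPoints P → x ∈ ⋃ k, F k := by
    intro b x hx
    obtain ⟨i, q, hq, he⟩ := mem_iUnion.1 hx
    have : x = q.2.2 := (congrArg Prod.snd he).symm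
    exact mem_iUnion.2 ⟨_, this ▸ (h _ q hq).1 (even_two_mul i)⟩
  refine ⟨⋃ k, F k, countable_iUnion hF, fun p hx hy => ⟨?_, fun hp => ?_⟩⟩
  · rintro ⟨-, hc | hc⟩
    · exact hx (hcrit _ _ hc)
    · exact hy (hcrit _ _ hc)
  · exact mem_phaseSpace_iff.2 ⟨hp, fun i => ⟨hlev p hx hy i, hlev (swap p) hy hx i⟩⟩

lemma ae_areaMeasure_notMem {F : Set Plane} (hF : F.Countable) :
    ∀ᵐ p ∂(areaMeasure P), p.2.1 ∉ F ∧ p.2.2 ∉ F := by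
  have key : ∀ v e : Plane, e ≠ 0 → ∀ᵐ s : ℝ, v + s • e ∉ F := by
    intro v e he
    have hinj : Function.Injective fun s : ℝ => v + s • e := fun s t hst =>
      smul_left_injective ℝ he (add_left_cancel hst)
    exact (hF.preimage hinj).ae_notMem volume
  unfold areaMeasure
  refine Measure.ae_sum_iff.2 fun b => Measure.ae_sum_iff.2 fun i =>
    Measure.ae_sum_iff.2 fun j => Measure.ae_smul_measure ?_ _
  have hmeas : MeasurableSet {p : PhasePoint | p.2.1 ∉ F ∧ p.2.2 ∉ F} := by
    have m1 : Measurable fun p : PhasePoint => p.2.1 := by fun_prop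
    have m2 : Measurable fun p : PhasePoint => p.2.2 := by fun_prop
    exact (m1 hF.measurableSet.compl).inter (m2 hF.measurableSet.compl)
  have hm : Measurable fun s : ℝ × ℝ => ((b, (P b).vertex i + s.1 • (P b).edgeVector i,
      (P !b).vertex j + s.2 • (P !b).edgeVector j) : PhasePoint) := by fun_prop
  refine (ae_map_iff hm.aemeasurable hmeas).2 (ae_restrict_of_ae ?_)
  rw [Measure.volume_eq_prod]
  filter_upwards [Measure.quasiMeasurePreserving_fst.ae
      (key ((P b).vertex i) _ ((P b).edgeVector_ne_zero i)),
    Measure.quasiMeasurePreserving_snd.ae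
      (key ((P !b).vertex j) _ ((P !b).edgeVector_ne_zero j))] with s h1 h2 using ⟨h1, h2⟩

/-! ### Counting tiles by critical points -/

/-- `w` is the last point of `T` before `x` on the half-open edge of `A` containing `x`. -/
def IsLeftPoint (A : Polygon) (T : Set Plane) (x w : Plane) : Prop :=
  ∃ i, ∃ a s : ℝ, 0 ≤ a ∧ a < s ∧ s < 1 ∧ x = A.vertex i + s • A.edgeVector i ∧
    w = A.vertex i + a • A.edgeVector i ∧ w ∈ T ∧
    ∀ u, a < u → u < s → A.vertex i + u • A.edgeVector i ∉ T

lemma exists_isLeftPoint {A : Polygon} {T : Set Plane} {i : ZMod A.n} {x : Plane} (hT : T.Finite)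
    (hV : A.vertices ⊆ T) (hx : x ∈ A.openEdge i) : ∃ w, IsLeftPoint A T x w := by
  obtain ⟨s, h0, h1, rfl⟩ := Polygon.mem_openEdge_iff_exists.1 hx
  set R : Set ℝ := {a | (0 ≤ a ∧ a < s) ∧ A.vertex i + a • A.edgeVector i ∈ T}
  have hinj : Function.Injective fun a : ℝ => A.vertex i + a • A.edgeVector i := fun a b hab =>
    smul_left_injective ℝ (A.edgeVector_ne_zero i) (add_left_cancel hab)
  have hR : R.Finite := (hT.preimage hinj.injOn).subset fun a ha => ha.2
  have hne : R.Nonempty := ⟨0, ⟨le_rfl, h0⟩, hV ⟨i, by simp⟩⟩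
  obtain ⟨a, ha, hmax⟩ := R.exists_max_image id hR hne
  refine ⟨_, i, a, s, ha.1.1, ha.1.2, h1, rfl, rfl, ha.2, fun u hau hus hu => ?_⟩
  exact absurd (hmax u ⟨⟨ha.1.1.trans hau.le, hus⟩, hu⟩) (not_le.2 hau)

/-- A chosen point `w` with `IsLeftPoint A T x w`. -/
def leftPoint (A : Polygon) (T : Set Plane) (x : Plane) : Plane :=
  Classical.epsilon fun w => IsLeftPoint A T x w

lemma isLeftPoint_leftPoint {A : Polygon} {T : Set Plane} {i : ZMod A.n} {x : Plane}
    (hT : T.Finite) (hV : A.vertices ⊆ T) (hx : x ∈ A.openEdge i) :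
    IsLeftPoint A T x (leftPoint A T x) :=
  Classical.epsilon_spec (exists_isLeftPoint hT hV hx)

lemma halfOpenEdge_unique {A : Polygon} {i j : ZMod A.n} {a b : ℝ} (ha : 0 ≤ a) (ha1 : a < 1)
    (hb : 0 ≤ b) (hb1 : b < 1)
    (h : A.vertex i + a • A.edgeVector i = A.vertex j + b • A.edgeVector j) : i = j ∧ a = b := by
  rcases ha.eq_or_lt with rfl | ha0
  · rcases hb.eq_or_lt with rfl | hb0
    · simp only [zero_smul, add_zero] at h
      exact ⟨A.vertex_injective h, rfl⟩
    · rw [zero_smul, add_zero] at h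
      exact absurd (Polygon.mem_openEdge_iff_exists.2 ⟨b, hb0, hb1, h⟩) (A.vertex_notMem_edge i j)
  · rcases hb.eq_or_lt with rfl | hb0
    · rw [zero_smul, add_zero] at h
      exact absurd (Polygon.mem_openEdge_iff_exists.2 ⟨a, ha0, ha1, h.symm⟩)
        (A.vertex_notMem_edge j i)
    · obtain rfl := Polygon.openEdge_unique
        (Polygon.mem_openEdge_iff_exists.2 ⟨a, ha0, ha1, rfl⟩)
        (Polygon.mem_openEdge_iff_exists.2 ⟨b, hb0, hb1, h⟩)
      exact ⟨rfl, smul_left_injective ℝ (A.edgeVector_ne_zero i) (add_left_cancel h)⟩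

/-- Points with the same left point can be moved along their edge to a common point without meeting
the set. -/
lemma IsLeftPoint.exists_common {A : Polygon} {T : Set Plane} {x x' w : Plane}
    (h : IsLeftPoint A T x w) (h' : IsLeftPoint A T x' w) : ∃ (i : ZMod A.n) (v v' : Plane),
      x + v = x' + v' ∧ (∀ t ∈ Icc (0 : ℝ) 1, x + t • v ∈ A.openEdge i) ∧
      (∀ t ∈ Ioc (0 : ℝ) 1, x + t • v ∉ T) ∧ (∀ t ∈ Icc (0 : ℝ) 1, x' + t • v' ∈ A.openEdge i) ∧
      ∀ t ∈ Ioc (0 : ℝ) 1, x' + t • v' ∉ T := by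
  obtain ⟨i, a, s, ha, has, hs, rfl, hw, -, hT⟩ := h
  obtain ⟨i', a', s', ha', has', hs', rfl, hw', -, hT'⟩ := h'
  obtain ⟨rfl, rfl⟩ := halfOpenEdge_unique ha (has.trans hs) ha' (has'.trans hs') (hw ▸ hw')
  set m := min s s'
  set u := (a + m) / 2 with hu
  have ham : a < m := lt_min has has'
  have hms : m ≤ s := min_le_left _ _
  have hms' : m ≤ s' := min_le_right _ _
  have e : ∀ r t : ℝ, A.vertex i + r • A.edgeVector i + t • (u - r) • A.edgeVector i =
      A.vertex i + (r + t * (u - r)) • A.edgeVector i := by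
    intro r t; rw [smul_smul, add_assoc, ← add_smul]
  refine ⟨i, (u - s) • A.edgeVector i, (u - s') • A.edgeVector i, ?_, ?_, ?_, ?_, ?_⟩
  · rw [add_assoc, add_assoc, ← add_smul, ← add_smul]; congr 2; ring
  · intro t ht
    rw [e]
    exact Polygon.mem_openEdge_iff_exists.2
      ⟨_, by nlinarith [ht.1, ht.2], by nlinarith [ht.1, ht.2], rfl⟩
  · intro t ht
    rw [e]
    exact hT _ (by nlinarith [ht.1, ht.2]) (by nlinarith [ht.1, ht.2])
  · intro t ht
    rw [e]
    exact Polygon.mem_openEdge_iff_exists.2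
      ⟨_, by nlinarith [ht.1, ht.2], by nlinarith [ht.1, ht.2], rfl⟩
  · intro t ht
    rw [e]
    exact hT' _ (by nlinarith [ht.1, ht.2]) (by nlinarith [ht.1, ht.2])

lemma vertices_subset_criticalPointsOn (b : Bool) : (P b).vertices ⊆ criticalPointsOn P b := by
  intro v hv
  refine mem_iUnion.2 ⟨0, (!b, (P !b).vertex 0, v), ⟨Polygon.vertex_mem_curve _, ?_⟩, ?_⟩
  · simpa using hv
  · simp [proj₂]

lemma finite_criticalPointsOn (h : (criticalPoints P).Finite) (b : Bool) :
    (criticalPointsOn P b).Finite :=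
  h.preimage fun _ _ _ _ hxy => congrArg Prod.snd hxy

/-- The last critical points before the two entries of `p`: the corner of a rectangle in the
complement of the `C`-grid that lies in the tile of `p`, if there are finitely many critical
points. -/
def corner (p : phaseSpace P) : Plane × Plane :=
  (leftPoint (P p.1.1) (criticalPointsOn P p.1.1) p.1.2.1,
    leftPoint (P !p.1.1) (criticalPointsOn P !p.1.1) p.1.2.2)

lemma isLeftPoint_corner (h : (criticalPoints P).Finite) (p : phaseSpace P) :
    IsLeftPoint (P p.1.1) (criticalPointsOn P p.1.1) p.1.2.1 (corner p).1 ∧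
      IsLeftPoint (P !p.1.1) (criticalPointsOn P !p.1.1) p.1.2.2 (corner p).2 := by
  obtain ⟨i, j, hx, hy, -⟩ := phaseSpace_subset_transversalPairs p.2
  have hV := vertices_subset_criticalPointsOn (P := P)
  exact ⟨isLeftPoint_leftPoint (finite_criticalPointsOn h _) (hV _) hx,
    isLeftPoint_leftPoint (finite_criticalPointsOn h _) (hV _) hy⟩

lemma corner_mem (h : (criticalPoints P).Finite) (p : phaseSpace P) :
    (corner p).1 ∈ criticalPointsOn P p.1.1 ∧ (corner p).2 ∈ criticalPointsOn P !p.1.1 := by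
  obtain ⟨⟨_, _, _, _, _, _, _, _, h1, _⟩, ⟨_, _, _, _, _, _, _, _, h2, _⟩⟩ :=
    isLeftPoint_corner h p
  exact ⟨h1, h2⟩

lemma sameTile_of_corner_eq (h : (criticalPoints P).Finite) {p q : phaseSpace P}
    (hl : p.1.1 = q.1.1) (hc : corner p = corner q) : SameTile p q := by
  obtain ⟨h1, h2⟩ := isLeftPoint_corner h p
  obtain ⟨h3, h4⟩ := isLeftPoint_corner h q
  rw [← hc] at h3 h4
  generalize corner p = k at h1 h2 h3 h4
  clear hc
  obtain ⟨⟨b, x, y⟩, hp⟩ := p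
  obtain ⟨⟨b', x', y'⟩, hq⟩ := q
  dsimp only at hl h1 h2 h3 h4
  subst hl
  obtain ⟨i, v, v', e1, a1, a2, a3, a4⟩ := h1.exists_common h3
  obtain ⟨j, u, u', e2, b1, b2, b3, b4⟩ := h2.exists_common h4
  obtain ⟨r, hr, hs⟩ := exists_sameTile ⟨_, hp⟩ a1 (fun _ => a2) b1 (fun _ => b2)
  obtain ⟨r', hr', hs'⟩ := exists_sameTile ⟨_, hq⟩ a3 (fun _ => a4) b3 (fun _ => b4)
  have : r = r' := Subtype.ext (by rw [hr, hr', e1, e2])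
  subst this
  exact hs.trans hs'.symm

lemma isolated_of_finite (h : (criticalPoints P).Finite) (b : Bool) (x : Plane) :
    ∀ᶠ y in 𝓝[≠] x, (b, y) ∉ criticalPoints P := by
  have hf : (criticalPointsOn P b \ {x}).Finite := (finite_criticalPointsOn h b).sdiff
  rw [eventually_nhdsWithin_iff]
  filter_upwards [hf.isClosed.isOpen_compl.mem_nhds
    (show x ∈ (criticalPointsOn P b \ {x})ᶜ by simp)] with y hy hne hyc
  exact hy ⟨hyc, hne⟩

/-- Among the orbit of a point, the labels and corners take at most `2 |C ∩ P₋| |C ∩ P₊|` values. -/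
theorem exists_hasOrbitOfPeriod_le (h : (criticalPoints P).Finite) (p : phaseSpace P) :
    ∃ n ≤ 4 * (criticalPointsOn P false).ncard * (criticalPointsOn P true).ncard,
      HasOrbitOfPeriod (billiardMap P) (phaseSpace P) p n := by
  set F : Bool → Finset Plane := fun b => (finite_criticalPointsOn h b).toFinset with hF
  have hcard : ∀ b, (F b).card = (criticalPointsOn P b).ncard := fun b =>
    (ncard_eq_toFinset_card _ (finite_criticalPointsOn h b)).symm
  set M := 2 * ((criticalPointsOn P false).ncard * (criticalPointsOn P true).ncard) with hM
  set T : Finset (Bool × Plane × Plane) :=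
    Finset.univ.biUnion fun b => {b} ×ˢ (F b ×ˢ F !b) with hT
  have hTcard : T.card ≤ M := by
    refine Finset.card_biUnion_le.trans (le_of_eq ?_)
    simp only [Fintype.sum_bool, Finset.card_product, Finset.card_singleton, hcard, hM,
      Bool.not_true, Bool.not_false]
    ring
  set f : ℕ → Bool × Plane × Plane := fun k => (((flow P ^ k) p).1.1, corner ((flow P ^ k) p))
  obtain ⟨m, hm, n, hn, hne, hmn⟩ := Finset.exists_ne_map_eq_of_card_lt_of_maps_to
    (s := Finset.range (M + 1)) (t := T) (f := f) (by rw [Finset.card_range]; omega) (fun k _ => by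
      obtain ⟨h1, h2⟩ := corner_mem h ((flow P ^ k) p)
      refine Finset.mem_coe.2 (Finset.mem_biUnion.2 ⟨_, Finset.mem_univ _, Finset.mem_product.2
        ⟨Finset.mem_singleton_self _, Finset.mem_product.2 ⟨?_, ?_⟩⟩⟩)
      · simpa [hF] using h1
      · simpa [hF] using h2)
  wlog hlt : m < n generalizing m n
  · exact this n hn m hm hne.symm hmn.symm (lt_of_le_of_ne (not_lt.1 hlt) hne.symm)
  have h1 := congrArg Prod.fst hmn
  have h2 := sameTile_of_corner_eq h h1 (congrArg Prod.snd hmn)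
  obtain ⟨α, hα, β, hβ, hbox⟩ :=
    exists_hasBox p (isolated_of_finite h _ _) (isolated_of_finite h _ _)
  refine ⟨_, ?_, hasOrbitOfPeriod_of_sameTile hlt h1 h2 (hbox.exists_fst_ne hα hβ)
    (hbox.exists_snd_ne hα hβ)⟩
  have := Finset.mem_range.1 hn
  rw [mul_assoc]
  omega

/-! ### A single table -/

section SingleTable

variable {A : Polygon}

lemma mem_discontinuityLevel_doubled {k : ℕ} {b b' : Bool} {q : Plane × Plane}
    (h : ((b, q) : PhasePoint) ∈ discontinuityLevel (doubled A) k) :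
    ((b', q) : PhasePoint) ∈ discontinuityLevel (doubled A) k := by
  induction k generalizing b b' q with
  | zero => exact h
  | succ k ih => exact ⟨h.1, ih h.2⟩

lemma mem_phaseSpace_doubled {b b' : Bool} {q : Plane × Plane}
    (h : ((b, q) : PhasePoint) ∈ phaseSpace (doubled A)) :
    ((b', q) : PhasePoint) ∈ phaseSpace (doubled A) := by
  obtain ⟨h1, h2⟩ := mem_phaseSpace_iff.1 h
  exact mem_phaseSpace_iff.2 ⟨h1, fun i => ⟨fun hi => (h2 i).1 (mem_discontinuityLevel_doubled hi),
    fun hi => (h2 i).2 (mem_discontinuityLevel_doubled (b' := !b) hi)⟩⟩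

lemma criticalPointsOn_doubled (b : Bool) :
    criticalPointsOn (doubled A) b = singleCriticalPoints A := by
  have h : ∀ b b' x, (b, x) ∈ criticalPoints (doubled A) →
      (b', x) ∈ criticalPoints (doubled A) := by
    intro b b' x hx
    obtain ⟨i, ⟨c, q⟩, hq, he⟩ := mem_iUnion.1 hx
    refine mem_iUnion.2 ⟨i, (!b', q), mem_discontinuityLevel_doubled hq, ?_⟩
    have : q.2 = x := congrArg Prod.snd he
    simp [proj₂, this]
  exact Set.ext fun x => ⟨h b false x, h false b x⟩

lemma finite_criticalPoints_doubled (h : (singleCriticalPoints A).Finite) :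
    (criticalPoints (doubled A)).Finite := by
  refine ((finite_univ (α := Bool)).prod h).subset ?_
  rintro ⟨b, x⟩ hx
  refine ⟨mem_univ _, ?_⟩
  rw [← criticalPointsOn_doubled b]
  exact hx

/-- Exchange of the two copies of the table. -/
def relabel (p : phaseSpace (doubled A)) : phaseSpace (doubled A) :=
  ⟨(!p.1.1, p.1.2), mem_phaseSpace_doubled p.2⟩

lemma flow_relabel (p : phaseSpace (doubled A)) :
    flow (doubled A) (relabel p) = relabel (flow (doubled A) p) := rfl

lemma flow_zpow_relabel (k : ℤ) (p : phaseSpace (doubled A)) :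
    (flow (doubled A) ^ k) (relabel p) = relabel ((flow (doubled A) ^ k) p) := by
  have e : ∀ (k : ℤ) r, (flow (doubled A) ^ (k + 1)) r =
      flow (doubled A) ((flow (doubled A) ^ k) r) := fun k r => by
    rw [add_comm, zpow_add, zpow_one, Equiv.Perm.mul_apply]
  induction k using Int.induction_on with
  | zero => rfl
  | succ k ih => rw [e, e, ih, flow_relabel]
  | pred k ih =>
    apply (flow (doubled A)).injective
    rw [flow_relabel, ← e, ← e]
    simpa only [sub_add_cancel] using ih

lemma sameTile_relabel (p : phaseSpace (doubled A)) : SameTile p (relabel p) := fun k => by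
  rw [flow_zpow_relabel]; rfl

lemma corner_relabel (p : phaseSpace (doubled A)) : corner (relabel p) = corner p := by
  simp only [corner, criticalPointsOn_doubled]; rfl

lemma sameTile_of_corner_eq_doubled (h : (singleCriticalPoints A).Finite)
    {p q : phaseSpace (doubled A)} (hc : corner p = corner q) : SameTile p q := by
  have hf := finite_criticalPoints_doubled h
  by_cases hl : p.1.1 = q.1.1
  · exact sameTile_of_corner_eq hf hl hc
  · refine (sameTile_of_corner_eq (q := relabel q) hf ?_ (by rw [corner_relabel, hc])).trans
      (sameTile_relabel q).symm
    exact Bool.eq_not.2 hl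

lemma code_fst_ne_snd (p : phaseSpace P) : (code P p).1 ≠ (code P p).2 := by
  intro h
  have := det_code_ne_zero p
  rw [h, det_self] at this
  exact this rfl

/-- Tiles off the diagonal: the two entries of a phase point lie on different edges. -/
lemma corner_fst_ne_snd (h : (singleCriticalPoints A).Finite) (p : phaseSpace (doubled A)) :
    (corner p).1 ≠ (corner p).2 := by
  intro hc
  obtain ⟨h1, h2⟩ := isLeftPoint_corner (finite_criticalPoints_doubled h) p
  rw [← hc] at h2
  obtain ⟨i, v, v', -, h3, -, h4, -⟩ := IsLeftPoint.exists_common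
    (A := A) (T := singleCriticalPoints A)
    (by rw [← criticalPointsOn_doubled p.1.1]; exact h1)
    (by rw [← criticalPointsOn_doubled !p.1.1]; exact h2)
  have hx := h3 0 ⟨le_rfl, zero_le_one⟩
  have hy := h4 0 ⟨le_rfl, zero_le_one⟩
  rw [zero_smul, add_zero] at hx hy
  exact code_fst_ne_snd p ((edgeCode_of_mem hx).trans (edgeCode_of_mem hy).symm)

/-- If a tile returns to itself after an odd number of steps, then its orbit does not contain the
swapped tile of any of its members: otherwise a tile in the orbit would be its own swap, and so lie
on the diagonal. -/
lemma not_sameTile_flip {p : phaseSpace P} {n : ℕ} (hn : Odd n)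
    (h : SameTile p ((flow P ^ n) p)) (k l : ℕ) :
    ¬ SameTile ((flow P ^ k) p) (flip ((flow P ^ l) p)) := by
  intro hkl
  obtain ⟨r, hr⟩ := hn
  set m : ℤ := k + l with hm
  have hz : SameTile p ((flow P ^ (n : ℤ)) p) := by rwa [zpow_natCast]
  have h1 := hkl.zpow l
  rw [← zpow_natCast, ← zpow_natCast, flip_zpow, ← Equiv.Perm.mul_apply, ← Equiv.Perm.mul_apply,
    ← zpow_add, ← zpow_add, add_neg_cancel, zpow_zero, Equiv.Perm.one_apply, add_comm, ← hm] at h1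
  -- Since `n = 2 r + 1`, the exponent `m` is `2 j` modulo `n` for `j = -(m r)`.
  have h2 := ((sameTile_zpow_mul hz m).zpow (2 * -(m * r)))
  rw [← Equiv.Perm.mul_apply, ← zpow_add] at h2
  have e : 2 * -(m * r) + (n : ℤ) * m = m := by rw [hr]; push_cast; ring
  rw [e] at h2
  have h3 := (h2.trans h1).zpow (-(-(m * r)))
  rw [← Equiv.Perm.mul_apply, ← zpow_add, ← flip_zpow] at h3
  have e' : -(-(m * (r : ℤ))) + 2 * -(m * r) = -(m * r) := by ring
  rw [e'] at h3
  have h4 := h3.code_eq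
  have h5 : code P (flip ((flow P ^ (-(m * (r : ℤ)))) p)).1 =
      (code P ((flow P ^ (-(m * (r : ℤ)))) p).1).swap := code_swap _
  rw [h5] at h4
  exact code_fst_ne_snd _ (congrArg Prod.fst h4)

/-- The corners of two equal tables lie off the diagonal of `C × C`, whatever the labels. An even
tile period `n` gives the period `2 n`, and an odd one the period `4 n`. -/
theorem exists_period_doubled (h : (singleCriticalPoints A).Finite)
    (p : phaseSpace (doubled A)) :
    ∃ n ≤ 2 * ((singleCriticalPoints A).ncard ^ 2 - (singleCriticalPoints A).ncard),
      HasOrbitOfPeriod (billiardMap (doubled A)) (phaseSpace (doubled A)) p n := by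
  classical
  have hf := finite_criticalPoints_doubled h
  set T := h.toFinset.offDiag with hT
  have hTcard : T.card = (singleCriticalPoints A).ncard ^ 2 - (singleCriticalPoints A).ncard := by
    rw [hT, Finset.offDiag_card, ← ncard_eq_toFinset_card _ h, sq]
  have hmem : ∀ q : phaseSpace (doubled A), corner q ∈ T := by
    intro q
    obtain ⟨h1, h2⟩ := corner_mem hf q
    rw [criticalPointsOn_doubled] at h1 h2
    exact Finset.mem_offDiag.2 ⟨h.mem_toFinset.2 h1, h.mem_toFinset.2 h2, corner_fst_ne_snd h q⟩
  have hex : ∃ n, 0 < n ∧ SameTile p ((flow (doubled A) ^ n) p) := by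
    have hmaps : MapsTo (fun k : ℕ => corner ((flow (doubled A) ^ k) p)) univ
        (T : Set (Plane × Plane)) :=
      fun k _ => hmem _
    obtain ⟨m, -, n, -, hne, hmn⟩ := infinite_univ.exists_ne_map_eq_of_mapsTo hmaps T.finite_toSet
    wlog hlt : m < n generalizing m n
    · exact this n m hne.symm hmn.symm (lt_of_le_of_ne (not_lt.1 hlt) hne.symm)
    exact ⟨n - m, by omega, sameTile_of_sameTile_iterates hlt (sameTile_of_corner_eq_doubled h hmn)⟩
  set n := Nat.find hex with hn
  obtain ⟨hn0, hper⟩ := Nat.find_spec hex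
  rw [← hn] at hn0 hper
  have hinj : ∀ k < n, ∀ l < n,
      SameTile ((flow (doubled A) ^ k) p) ((flow (doubled A) ^ l) p) → k = l := by
    intro k hk l hl hkl
    by_contra hne
    wlog hlt : k < l generalizing k l
    · exact this l hl k hk hkl.symm (Ne.symm hne) (lt_of_le_of_ne (not_lt.1 hlt) (Ne.symm hne))
    exact Nat.find_min hex (m := l - k) (by omega)
      ⟨by omega, sameTile_of_sameTile_iterates hlt hkl⟩
  obtain ⟨α, hα, β, hβ, hbox⟩ := exists_hasBox p (isolated_of_finite hf _ _)
    (isolated_of_finite hf _ _)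
  have hx := hbox.exists_fst_ne hα hβ
  have hy := hbox.exists_snd_ne hα hβ
  rw [← hTcard]
  rcases Nat.even_or_odd n with heven | hodd
  · have hle : n ≤ T.card := by
      rw [← Finset.card_range n]
      refine Finset.card_le_card_of_injOn (fun k => corner ((flow (doubled A) ^ k) p))
        (fun k _ => hmem _) fun k hk l hl hkl => ?_
      exact hinj k (by simpa using hk) l (by simpa using hl) (sameTile_of_corner_eq_doubled h hkl)
    obtain ⟨k, hk⟩ := heven
    rw [← two_mul] at hk
    rw [hk] at hper hle hn0
    exact ⟨2 * (2 * k), by omega, hasOrbitOfPeriod (by omega) (flow_pow_eq_self hper hx hy)⟩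
  · -- The tiles in the orbit and their swaps are pairwise different.
    have hle : 2 * n ≤ T.card := by
      have hc : (Finset.range n ×ˢ (Finset.univ : Finset Bool)).card = 2 * n := by
        rw [Finset.card_product, Finset.card_range, Finset.card_univ, Fintype.card_bool, mul_comm]
      rw [← hc]
      refine Finset.card_le_card_of_injOn (fun kb => corner (if kb.2
        then flip ((flow (doubled A) ^ kb.1) p) else (flow (doubled A) ^ kb.1) p))
        (fun k _ => hmem _) ?_
      rintro ⟨k, b⟩ hk ⟨l, c⟩ hl hkl
      have hk' : k < n := by simpa using hk
      have hl' : l < n := by simpa using hl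
      have hs := sameTile_of_corner_eq_doubled h hkl
      cases b <;> cases c
      · rw [hinj k hk' l hl' hs]
      · exact absurd hs (not_sameTile_flip hodd hper k l)
      · exact absurd hs.symm (not_sameTile_flip hodd hper l k)
      · have := hs.flip
        simp only [if_true, flip_flip] at this
        rw [hinj k hk' l hl' this]
    have h2 : SameTile p ((flow (doubled A) ^ (2 * n)) p) := by
      have hz : SameTile p ((flow (doubled A) ^ (n : ℤ)) p) := by rwa [zpow_natCast]
      have h3 := sameTile_zpow_mul hz 2
      have e : (n : ℤ) * 2 = ((2 * n : ℕ) : ℤ) := by push_cast; ring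
      rwa [e, zpow_natCast] at h3
    exact ⟨2 * (2 * n), by omega, hasOrbitOfPeriod (by omega) (flow_pow_eq_self h2 hx hy)⟩

/-- Forgetting the labels turns orbits of the pair of copies into orbits of the single table. -/
lemma hasOrbitOfPeriod_single {q : Plane × Plane} {n : ℕ}
    (h : HasOrbitOfPeriod (billiardMap (doubled A)) (phaseSpace (doubled A)) (false, q) n) :
    HasOrbitOfPeriod (singleMap A) (singlePhaseSpace A) q n := by
  obtain ⟨hn, ⟨o, ho⟩, hall⟩ := h
  refine ⟨hn, ⟨fun k => (o k).2, ?_, fun k => ⟨mem_phaseSpace_doubled (ho.2 k).1, ?_⟩⟩, ?_⟩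
  · simp only [ho.1]
  · have h1 : singleMap A (o k).2 = (billiardMap (doubled A) (o k)).2 := rfl
    rw [h1, (ho.2 k).2]
  · intro o' ho' k
    have h1 : IsOrbit (billiardMap (doubled A)) (phaseSpace (doubled A)) (false, q)
        fun k => (k.bodd, o' k) := by
      refine ⟨by simp [ho'.1], fun k => ⟨mem_phaseSpace_doubled (ho'.2 k).1, ?_⟩⟩
      refine Prod.ext ?_ (ho'.2 k).2
      simp [billiardMap, Int.bodd_add]
    exact congrArg Prod.snd (hall _ h1 k)

end SingleTable

lemma isolated_of_not_accPt {b : Bool} {x : Plane} (h : ¬ AccPt (b, x) (𝓟 (criticalPoints P))) :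
    ∀ᶠ y in 𝓝[≠] x, (b, y) ∉ criticalPoints P := by
  rw [accPt_iff_frequently_nhdsNE, not_frequently] at h
  refine Tendsto.eventually (f := fun y => (b, y)) ?_ h
  have hc : ContinuousAt (fun y : Plane => (b, y)) x := by fun_prop
  refine tendsto_nhdsWithin_iff.2 ⟨hc.tendsto.mono_left nhdsWithin_le_nhds, ?_⟩
  filter_upwards [self_mem_nhdsWithin] with y hy he
  exact hy (congrArg Prod.snd he)

lemma isolated_of_isClosed (h : IsClosed (criticalPoints P)) {b : Bool} {x : Plane}
    (hx : (b, x) ∉ criticalPoints P) : ∀ᶠ y in 𝓝[≠] x, (b, y) ∉ criticalPoints P := by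
  have hc : ContinuousAt (fun y : Plane => (b, y)) x := by fun_prop
  exact nhdsWithin_le_nhds (hc.eventually (h.isOpen_compl.mem_nhds hx))

lemma exists_hasOrbitOfPeriod_of_isolated (p : phaseSpace P)
    (hx : ∀ᶠ y in 𝓝[≠] p.1.2.1, (p.1.1, y) ∉ criticalPoints P)
    (hy : ∀ᶠ y in 𝓝[≠] p.1.2.2, (!p.1.1, y) ∉ criticalPoints P) :
    ∃ n, HasOrbitOfPeriod (billiardMap P) (phaseSpace P) p n := by
  obtain ⟨α, hα, β, hβ, hbox⟩ := exists_hasBox p hx hy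
  exact hbox.exists_hasOrbitOfPeriod hα hβ

lemma exists_hasOrbitOfPeriod_of_isClosed (h : IsClosed (criticalPoints P)) {p : PhasePoint}
    (hp : p ∈ phaseSpace P \ criticalGrid P) :
    ∃ n, HasOrbitOfPeriod (billiardMap P) (phaseSpace P) p n := by
  obtain ⟨hp, hg⟩ := hp
  have hpairs := (mem_phaseSpace_iff.1 hp).1.1
  exact exists_hasOrbitOfPeriod_of_isolated ⟨p, hp⟩
    (isolated_of_isClosed h fun hc => hg ⟨hpairs, Or.inl hc⟩)
    (isolated_of_isClosed h fun hc => hg ⟨hpairs, Or.inr hc⟩)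

end SymplecticBilliard

end

theorem theorem3p3 :
    (∀ P : Bool → SymplecticBilliard.Polygon,
      -- (I)
      ((∀ c : Bool × SymplecticBilliard.Plane,
          AccPt c (𝓟 (SymplecticBilliard.criticalPoints P)) → c.2 ∈ (P c.1).vertices) →
        ∀ p ∈ SymplecticBilliard.phaseSpace P, ∃ n,
          SymplecticBilliard.HasOrbitOfPeriod (SymplecticBilliard.billiardMap P)
            (SymplecticBilliard.phaseSpace P) p n) ∧
      -- (II)
      (IsClosed (SymplecticBilliard.criticalPoints P) →
        (∀ p ∈ SymplecticBilliard.phaseSpace P \ SymplecticBilliard.criticalGrid P, ∃ n,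
          SymplecticBilliard.HasOrbitOfPeriod (SymplecticBilliard.billiardMap P)
            (SymplecticBilliard.phaseSpace P) p n) ∧
        (∀ᵐ p ∂(SymplecticBilliard.areaMeasure P), p ∈ SymplecticBilliard.maxPhaseSpace P → ∃ n,
          SymplecticBilliard.HasOrbitOfPeriod (SymplecticBilliard.billiardMap P)
            (SymplecticBilliard.phaseSpace P) p n)) ∧
      -- (III) for a pair of tables
      ((SymplecticBilliard.criticalPoints P).Finite →
        ∀ p ∈ SymplecticBilliard.phaseSpace P,
          ∃ n ≤ 4 * (SymplecticBilliard.criticalPointsOn P false).ncard *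
              (SymplecticBilliard.criticalPointsOn P true).ncard,
            SymplecticBilliard.HasOrbitOfPeriod (SymplecticBilliard.billiardMap P)
              (SymplecticBilliard.phaseSpace P) p n)) ∧
    -- (III) for a single table, for its own map and for the map of the pair of two copies
    (∀ A : SymplecticBilliard.Polygon,
      (SymplecticBilliard.singleCriticalPoints A).Finite →
        (∀ q ∈ SymplecticBilliard.singlePhaseSpace A,
          ∃ n ≤ 2 * ((SymplecticBilliard.singleCriticalPoints A).ncard ^ 2 -
              (SymplecticBilliard.singleCriticalPoints A).ncard),
            SymplecticBilliard.HasOrbitOfPeriod (SymplecticBilliard.singleMap A)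
              (SymplecticBilliard.singlePhaseSpace A) q n) ∧
        (∀ p ∈ SymplecticBilliard.phaseSpace (SymplecticBilliard.doubled A),
          ∃ n ≤ 2 * ((SymplecticBilliard.singleCriticalPoints A).ncard ^ 2 -
              (SymplecticBilliard.singleCriticalPoints A).ncard),
            SymplecticBilliard.HasOrbitOfPeriod
              (SymplecticBilliard.billiardMap (SymplecticBilliard.doubled A))
              (SymplecticBilliard.phaseSpace (SymplecticBilliard.doubled A)) p n)) := by
  refine ⟨fun P => ⟨fun h p hp => ?_, fun h => ⟨fun p hp => ?_, ?_⟩, fun h p hp => ?_⟩,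
    fun A h => ⟨fun q hq => ?_, fun p hp => ?_⟩⟩
  · have ht := SymplecticBilliard.phaseSpace_subset_transversalPairs hp
    obtain ⟨i, j, hx, hy, -⟩ := ht
    exact SymplecticBilliard.exists_hasOrbitOfPeriod_of_isolated ⟨p, hp⟩
      (SymplecticBilliard.isolated_of_not_accPt fun hc =>
        SymplecticBilliard.Polygon.notMem_vertices_of_mem_openEdge hx (h _ hc))
      (SymplecticBilliard.isolated_of_not_accPt fun hc =>
        SymplecticBilliard.Polygon.notMem_vertices_of_mem_openEdge hy (h _ hc))
  · exact SymplecticBilliard.exists_hasOrbitOfPeriod_of_isClosed h hp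
  · obtain ⟨F, hF, hreg⟩ := SymplecticBilliard.exists_countable_exceptional P
    filter_upwards [SymplecticBilliard.ae_areaMeasure_notMem hF] with p hpF hmax
    obtain ⟨hgrid, hphase⟩ := hreg p hpF.1 hpF.2
    exact SymplecticBilliard.exists_hasOrbitOfPeriod_of_isClosed h ⟨hphase hmax, hgrid⟩
  · exact SymplecticBilliard.exists_hasOrbitOfPeriod_le h ⟨p, hp⟩
  · obtain ⟨n, hn, hper⟩ := SymplecticBilliard.exists_period_doubled h ⟨(false, q), hq⟩
    exact ⟨n, hn, SymplecticBilliard.hasOrbitOfPeriod_single hper⟩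
  · exact SymplecticBilliard.exists_period_doubled h ⟨p, hp⟩
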